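/- \textbf{Setting.} Let $\beta\in(0,1)$, $\epsilon>0$, $\omega_\beta(t)=t^{\beta-1}/\Gamma(\beta)$, and let $\Omega=(0,L_1)\times(0,L_2)$ with periodic boundary conditions, $\|\cdot\|$ being the $L^2(\Omega)$ norm. Let $0=t_0<t_1<\dots<t_N$, $\tau_k=t_k-t_{k-1}$ and $r_k=\tau_k/\tau_{k-1}$ for $k\ge2$. Write $w^{k-\frac12}=(w^k+w^{k-1})/2$, $\triangledown_\tau w^k=w^k-w^{k-1}$, $\partial_\tau w^k=\triangledown_\tau w^k/\tau_k$. Given midpoint values $w^{k-\frac12}$, let $$(\mathcal I_\tau^\beta w)^{n-\frac12}=\frac1{\tau_n}\int_{t_{n-1}}^{t_n}\int_0^t\omega_\beta(t-s)(\Pi_0w)(s)\,ds\,dt,\qquad (\Pi_0w)(s)=w^{k-\frac12}\ \text{ for } t_{k-1}<s\le t_k .$$ For $1\le k\le n$ put $$a^{(\beta,n)}_{n-k}=\frac1{\tau_n\tau_k}\int_{t_{n-1}}^{t_n}\int_{t_{k-1}}^{\min\{t,t_k\}}\omega_\beta(t-s)\,ds\,dt,$$ and let $\mathsf a^{(\beta,n)}_0=2a^{(\beta,n)}_0$,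 $\mathsf a^{(\beta,n)}_{n-k}=a^{(\beta,n)}_{n-k}$ for $1\le k\le n-1$. Define $$\theta^{(n)}_0=\frac1{\mathsf a^{(\beta,n)}_0},\qquad \theta^{(n)}_{n-k}=-\frac1{\mathsf a^{(\beta,k)}_0}\sum_{j=k+1}^n\theta^{(n)}_{n-j}\mathsf a^{(\beta,j)}_{j-k}\quad(1\le k\le n-1),$$ and, for $1\le k\le n$, the left- and right-complementary (DCC and RCC) kernels $$\mathsf p^{(\beta,n)}_{n-k}=\sum_{j=k}^n\theta^{(j)}_{j-k},\qquad \overleftarrow{\mathsf p}^{(\beta,n)}_{n-k}=\sum_{j=k}^n\theta^{(n)}_{n-j}.$$ \textbf{Scheme.} Let $u^0,\dots,u^N\in H^1_{\rm per}(\Omega)$ and $\zeta^{\frac12},\dots,\zeta^{N-\frac12}\in L^2(\Omega)$ satisfy, for $1\le n\le N$, $$\partial_\tau u^n+(\mathcal I_\tau^\beta\zeta)^{n-\frac12}=0\ \text{ a.e. in }\Omega,\qquad \zeta^{n-\frac12}=f(u)^{n-\frac12}-\epsilon^2\Delta u^{n-\frac12},$$ where $f(u)^{n-\frac12}=\frac12\big[(u^n)^2+(u^{n-1})^2\big]u^{n-\frac12}-u^{n-\frac12}$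 and the second equation holds in the sense of periodic distributions. Let $$E[u]=\int_\Omega\Big(\frac{\epsilon^2}2|\nabla u|^2+\frac14(u^2-1)^2\Big)dx,\qquad v^0=0,\quad v^j=\sum_{\ell=1}^j\mathsf a^{(\beta,j)}_{j-\ell}\tau_\ell\zeta^{\ell-\frac12},$$ $$\mathcal E_\beta[u^n]=E[u^n]+\frac12\sum_{j=1}^n\mathsf p^{(\beta,n)}_{n-j}\|v^j\|^2 .$$ \textbf{Theorem.} Assume the step-ratio constraint $$r_{k+1}\ge r_*(r_k):=\Big[\frac{(2^\beta-1)\rho(r_k)}{\rho(2r_k)-\rho(r_k)}\Big]^{\frac1{1-\beta}}\quad(2\le k\le N-1),\qquad \rho(z)=(z+1)^{1+\beta}-z^{1+\beta}-1 .$$ Then for $1\le n\le N$ the discrete energy dissipation law $$\partial_\tau\mathcal E_\beta[u^n]+\frac1{2\tau_n}\sum_{j=1}^{n-1}\Big(\frac1{\overleftarrow{\mathsf p}^{(\beta,n)}_{n-j}}-\frac1{\overleftarrow{\mathsf p}^{(\beta,n)}_{n-j-1}}\Big)\Big\|\sum_{k=1}^j\overleftarrow{\mathsf p}^{(\beta,n)}_{n-k}\triangledown_\tau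 v^k\Big\|^2=0$$ holds, with $\mathsf p^{(\beta,n)}_{n-j}>0$ and $\overleftarrow{\mathsf p}^{(\beta,n)}_{n-j}>0$ for $1\le j\le n$, and with every coefficient $1/\overleftarrow{\mathsf p}^{(\beta,n)}_{n-j}-1/\overleftarrow{\mathsf p}^{(\beta,n)}_{n-j-1}$ $(1\le j\le n-1)$ nonnegative. In particular the scheme is energy stable: $\mathcal E_\beta[u^n]\le\mathcal E_\beta[u^{n-1}]$. -/

import Mathlib

open MeasureTheory Filter Topology

noncomputable section

namespace TFKG

/-! ### Time mesh, step ratios and the averaged fractional integral -/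

/-- The Riemann-Liouville kernel `ω_β(t) = t^(β-1) / Γ(β)`. -/
def omega (β t : ℝ) : ℝ := t ^ (β - 1) / Real.Gamma β

/-- The time levels satisfy `0 = t₀ < t₁ < ⋯ < t_N` (the final time is `T = t_N`). -/
def IsMesh (N : ℕ) (t : ℕ → ℝ) : Prop :=
  t 0 = 0 ∧ ∀ k, 1 ≤ k → k ≤ N → t (k - 1) < t k

/-- Step sizes `τ_k = t_k - t_{k-1}`, used for `k ≥ 1`. -/
def step (t : ℕ → ℝ) (k : ℕ) : ℝ := t k - t (k - 1)

/-- Step ratios `r_k = τ_k / τ_{k-1}`, used for `k ≥ 2`. -/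
def ratio (t : ℕ → ℝ) (k : ℕ) : ℝ := step t k / step t (k - 1)

/-- `ρ(z) = (z+1)^(1+β) - z^(1+β) - 1`. -/
def rho (β z : ℝ) : ℝ := (z + 1) ^ (1 + β) - z ^ (1 + β) - 1

/-- `r_*(z) = [(2^β - 1) ρ(z) / (ρ(2z) - ρ(z))]^(1/(1-β))`. -/
def rStar (β z : ℝ) : ℝ :=
  (((2 : ℝ) ^ β - 1) * rho β z / (rho β (2 * z) - rho β z)) ^ (1 / (1 - β))

/-- The step-ratio constraint `r_{k+1} ≥ r_*(r_k)` for all `k ≥ 2` with `k + 1 ≤ N`. -/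
def StepRatioConstraint (β : ℝ) (N : ℕ) (t : ℕ → ℝ) : Prop :=
  ∀ k, 2 ≤ k → k + 1 ≤ N → rStar β (ratio t k) ≤ ratio t (k + 1)

/-- The piecewise constant interpolant `(Π₀ w)(s) = w_k` for `t_{k-1} < s ≤ t_k`,
where `w k` stands for the midpoint value `w^{k-1/2}`. -/
def interp (N : ℕ) (t : ℕ → ℝ) (w : ℕ → ℝ) (s : ℝ) : ℝ :=
  ∑ k ∈ Finset.Icc 1 N, (Set.Ioc (t (k - 1)) (t k)).indicator (fun _ => w k) s

/-- The integral averaged formula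
`(I_τ^β w)^{n-1/2} = (1/τ_n) ∫_{t_{n-1}}^{t_n} ∫_0^t ω_β(t-s) (Π₀ w)(s) ds dt`. -/
def avgIntegral (β : ℝ) (N : ℕ) (t : ℕ → ℝ) (w : ℕ → ℝ) (n : ℕ) : ℝ :=
  1 / step t n * ∫ x in t (n - 1)..t n, ∫ s in (0 : ℝ)..x, omega β (x - s) * interp N t w s

/-! ### Discrete kernels

A kernel `a^{(n)}_{n-k}`, `1 ≤ k ≤ n`, is written `a n k`, and similarly for all kernels below. -/

/-- `kernel β t n k = a^{(β,n)}_{n-k}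
  = 1/(τ_n τ_k) ∫_{t_{n-1}}^{t_n} ∫_{t_{k-1}}^{min(t,t_k)} ω_β(t-s) ds dt`. -/
def kernel (β : ℝ) (t : ℕ → ℝ) (n k : ℕ) : ℝ :=
  1 / (step t n * step t k) *
    ∫ x in t (n - 1)..t n, ∫ s in t (k - 1)..min x (t k), omega β (x - s)

/-- The modified kernels: the diagonal entry `a^{(β,n)}_0` is doubled. -/
def modKernel (β : ℝ) (t : ℕ → ℝ) (n k : ℕ) : ℝ :=
  if k = n then 2 * kernel β t n n else kernel β t n k

/-- The discrete orthogonal convolution kernels `doc a n k = θ^{(n)}_{n-k}`: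
`θ^{(n)}_0 = 1 / a^{(n)}_0` and
`θ^{(n)}_{n-k} = -(1 / a^{(k)}_0) ∑_{j=k+1}^n θ^{(n)}_{n-j} a^{(j)}_{j-k}` for `k < n`. -/
def doc (a : ℕ → ℕ → ℝ) (n k : ℕ) : ℝ :=
  if k < n then
    -(1 / a k k) * ∑ j ∈ (Finset.Icc (k + 1) n).attach, doc a n j.1 * a j.1 k
  else if k = n then 1 / a n n
  else 0
termination_by n - k
decreasing_by
  have h := Finset.mem_Icc.mp j.2
  omega

theorem doc_self (a : ℕ → ℕ → ℝ) (n : ℕ) : doc a n n = 1 / a n n := by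
  rw [doc]; simp

theorem doc_of_lt (a : ℕ → ℕ → ℝ) {n k : ℕ} (h : k < n) :
    doc a n k = -(1 / a k k) * ∑ j ∈ Finset.Icc (k + 1) n, doc a n j * a j k := by
  rw [doc, if_pos h, Finset.sum_attach (Finset.Icc (k + 1) n) (fun j => doc a n j * a j k)]

/-- The (left-)complementary kernels `dcc a n k = p^{(n)}_{n-k} = ∑_{j=k}^n θ^{(j)}_{j-k}`. -/
def dcc (a : ℕ → ℕ → ℝ) (n k : ℕ) : ℝ := ∑ j ∈ Finset.Icc k n, doc a j k

/-- The right-complementary kernels: `rcc a n k` has lower index `n - k` and upper index `n`, and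
equals `∑_{j=k}^n θ^{(n)}_{n-j}`. -/
def rcc (a : ℕ → ℕ → ℝ) (n k : ℕ) : ℝ := ∑ j ∈ Finset.Icc k n, doc a n j

/-! ### The periodic cell, the energy space and the scheme -/

/-- Lebesgue measure on the period cell `Ω = (0, L₁) × (0, L₂)`. -/
def cell (L₁ L₂ : ℝ) : Measure (ℝ × ℝ) :=
  volume.restrict (Set.Ioo 0 L₁ ×ˢ Set.Ioo 0 L₂)

/-- Smooth functions on the plane with period `L₁` in the first and `L₂` in the second variable. -/
def SmoothPeriodic (L₁ L₂ : ℝ) (φ : ℝ × ℝ → ℝ) : Prop :=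
  ContDiff ℝ ((⊤ : ℕ∞) : WithTop ℕ∞) φ ∧
    ∀ x y, φ (x + L₁, y) = φ (x, y) ∧ φ (x, y + L₂) = φ (x, y)

/-- Partial derivative in the first variable. -/
def dx (φ : ℝ × ℝ → ℝ) (z : ℝ × ℝ) : ℝ := fderiv ℝ φ z (1, 0)

/-- Partial derivative in the second variable. -/
def dy (φ : ℝ × ℝ → ℝ) (z : ℝ × ℝ) : ℝ := fderiv ℝ φ z (0, 1)

/-- The Laplacian of a smooth function. -/
def lap (φ : ℝ × ℝ → ℝ) (z : ℝ × ℝ) : ℝ := dx (dx φ) z + dy (dy φ) z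

/-- `u` lies in the periodic Sobolev space `H¹_per(Ω)`, with weak gradient `(g₁, g₂)`:
there are smooth periodic `φ_m` with `φ_m → u` and `∇φ_m → (g₁, g₂)`, the gradients in `L²(Ω)`.
The functions are taken to converge in `L⁴(Ω)`, the space on which the quartic potential is finite;
in two dimensions this is the same as convergence in `L²(Ω)`, by `H¹ ⊂ L⁴`. -/
def HasPeriodicGradient (L₁ L₂ : ℝ) (u g₁ g₂ : ℝ × ℝ → ℝ) : Prop :=
  MemLp u 4 (cell L₁ L₂) ∧ MemLp g₁ 2 (cell L₁ L₂) ∧ MemLp g₂ 2 (cell L₁ L₂) ∧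
  ∃ φ : ℕ → ℝ × ℝ → ℝ, (∀ m, SmoothPeriodic L₁ L₂ (φ m)) ∧
    Tendsto (fun m => eLpNorm (fun z => φ m z - u z) 4 (cell L₁ L₂)) atTop (𝓝 0) ∧
    Tendsto (fun m => eLpNorm (fun z => dx (φ m) z - g₁ z) 2 (cell L₁ L₂)) atTop (𝓝 0) ∧
    Tendsto (fun m => eLpNorm (fun z => dy (φ m) z - g₂ z) 2 (cell L₁ L₂)) atTop (𝓝 0)

/-- The square of the `L²(Ω)` norm. -/
def normSq (L₁ L₂ : ℝ) (w : ℝ × ℝ → ℝ) : ℝ := ∫ z, (w z) ^ 2 ∂(cell L₁ L₂)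

/-- `E[u] = ∫_Ω (ε²/2 |∇u|² + F(u))` with `F(u) = (u² - 1)² / 4`, where `∇u = (g₁, g₂)`. -/
def energy (L₁ L₂ ε : ℝ) (u g₁ g₂ : ℝ × ℝ → ℝ) : ℝ :=
  ∫ z, (ε ^ 2 / 2 * (g₁ z ^ 2 + g₂ z ^ 2) + 1 / 4 * (u z ^ 2 - 1) ^ 2) ∂(cell L₁ L₂)

/-- The midpoint average `(a + b) / 2`. -/
def mid (a b : ℝ) : ℝ := (a + b) / 2

/-- The second-order approximation of the nonlinear term from the new value `a` and the old
value `b`: `f^{n-1/2} = (1/2)[(uⁿ)² + (u^{n-1})²] u^{n-1/2} - u^{n-1/2}`. -/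
def fHalf (a b : ℝ) : ℝ := 1 / 2 * (a ^ 2 + b ^ 2) * mid a b - mid a b

/-- `ζ ∈ L²(Ω)` equals `f(u)^{n-1/2} - ε² Δu^{n-1/2}` on the torus, for the new level `a = uⁿ` and
the old level `b = u^{n-1}`; the Laplacian is the one of periodic distributions. -/
def IsPotential (L₁ L₂ ε : ℝ) (a b ζ : ℝ × ℝ → ℝ) : Prop :=
  MemLp ζ 2 (cell L₁ L₂) ∧
  ∀ φ, SmoothPeriodic L₁ L₂ φ →
    ∫ z, ζ z * φ z ∂(cell L₁ L₂) =
      ∫ z, fHalf (a z) (b z) * φ z ∂(cell L₁ L₂)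
        - ε ^ 2 * ∫ z, mid (a z) (b z) * lap φ z ∂(cell L₁ L₂)

/-- The Crank-Nicolson scheme: for `1 ≤ n ≤ N`, with `ζ n = ζ^{n-1/2}`,
`∂_τ uⁿ + (I_τ^β ζ)^{n-1/2} = 0` almost everywhere in `Ω`, and
`ζ^{n-1/2} = f(u)^{n-1/2} - ε² Δu^{n-1/2}`. -/
def IsCNSolution (L₁ L₂ ε β : ℝ) (N : ℕ) (t : ℕ → ℝ) (u ζ : ℕ → ℝ × ℝ → ℝ) : Prop :=
  ∀ n, 1 ≤ n → n ≤ N →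
    IsPotential L₁ L₂ ε (u n) (u (n - 1)) (ζ n) ∧
    ∀ᵐ z ∂(cell L₁ L₂),
      (u n z - u (n - 1) z) / step t n + avgIntegral β N t (fun k => ζ k z) n = 0

/-- `v^j = ∑_{ℓ=1}^j 𝖺^{(β,j)}_{j-ℓ} τ_ℓ ζ^{ℓ-1/2}`, with `v⁰ = 0`. -/
def vSeq (β : ℝ) (t : ℕ → ℝ) (ζ : ℕ → ℝ × ℝ → ℝ) (j : ℕ) (z : ℝ × ℝ) : ℝ :=
  ∑ l ∈ Finset.Icc 1 j, modKernel β t j l * step t l * ζ l z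

/-- The discrete variational energy
`ℰ_β[uⁿ] = E[uⁿ] + (1/2) ∑_{j=1}^n 𝗉^{(β,n)}_{n-j} ‖v^j‖²`. -/
def varEnergy (L₁ L₂ ε β : ℝ) (t : ℕ → ℝ) (u g₁ g₂ ζ : ℕ → ℝ × ℝ → ℝ) (n : ℕ) : ℝ :=
  energy L₁ L₂ ε (u n) (g₁ n) (g₂ n) +
    1 / 2 * ∑ j ∈ Finset.Icc 1 n, dcc (modKernel β t) n j * normSq L₁ L₂ (vSeq β t ζ j)

end TFKG

end

/-! Write `A` for `modKernel` as a lower triangular matrix, `w_l = τ_l ζ^{l-1/2}` and `v = A w`.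
Because the diagonal of `A` is doubled, the averaged integral is `v^n - A_nn w_n / 2`. Testing the
scheme with `ζ` therefore gives `E[u^n] - E[u^{n-1}] = -(1/2) ∫ (2 v^n w_n - A_nn w_n²)`: the
nonlinear average and the midpoint gradient are exactly what makes the left side an energy increment
(`IsPotential.integral_sub_mul`).

The right side is handled by a purely algebraic identity (`discrete_gradient`). The kernels `doc`
are the inverse matrix of `A`, and summation by parts recovers `w_n` from the differences of `v`
with weights `rcc`. Repeated completion of squares then turns `2 v^n w_n - A_nn w_n²` into the
increment of `∑ p v²` plus the squares of the dissipation law.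

For the signs it suffices that the off-diagonal entries of `A⁻¹` are nonpositive (`doc_nonpos`) and
that `A` strictly increases along rows and decreases down columns. The first follows when `A_{n+1,k}
/ A_{n,k}` is nonincreasing in `k` (`modKernel_mul_le`). Away from the diagonal this is
log-convexity of `t^(β-1)` integrated over cells, on any mesh. At the diagonal it becomes an
inequality for `rho`, and only there is the step-ratio constraint used (`rho_mul_rho_le`). -/

namespace TFKG

/-! ### Inverses of lower triangular kernels and the discrete gradient identity. -/

section Kernels

open Finset

theorem sum_doc_mul (A : ℕ → ℕ → ℝ) {n k : ℕ} (hk : A k k ≠ 0) (hkn : k ≤ n) :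
    ∑ j ∈ Icc k n, doc A n j * A j k = if n = k then 1 else 0 := by
  rcases hkn.eq_or_lt with rfl | h
  · simp [doc_self, hk]
  · rw [if_neg h.ne', ← Finset.insert_Icc_add_one_left_eq_Icc hkn, sum_insert (by simp),
      doc_of_lt A h]
    field_simp
    ring

theorem doc_of_gt (A : ℕ → ℕ → ℝ) {n k : ℕ} (h : n < k) : doc A n k = 0 := by
  rw [doc, if_neg (by omega), if_neg (by omega)]

/-- The recursion makes `doc` a left inverse only; on the finite window `[k, n]` a left inverse of a
square matrix is also a right inverse. `B` is cut off above the diagonal because nothing is known of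
`A` there. -/
theorem sum_mul_doc (A : ℕ → ℕ → ℝ) {n k : ℕ} (hA : ∀ i, k ≤ i → i ≤ n → A i i ≠ 0)
    (hkn : k ≤ n) :
    ∑ j ∈ Icc k n, A n j * doc A j k = if n = k then 1 else 0 := by
  let T : Matrix (Icc k n) (Icc k n) ℝ := fun i j => doc A i j
  let B : Matrix (Icc k n) (Icc k n) ℝ := fun i j => if (j : ℕ) ≤ i then A i j else 0
  have hTB : T * B = 1 := by
    ext ⟨i, hi⟩ ⟨l, hl⟩
    rw [mem_Icc] at hi hl
    rw [Matrix.mul_apply]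
    simp only [T, B]
    rw [Finset.sum_coe_sort (Icc k n) (fun j => doc A i j * if l ≤ j then A j l else 0),
      Matrix.one_apply]
    simp only [Subtype.mk.injEq]
    by_cases hli : l ≤ i
    · rw [← sum_doc_mul A (hA l hl.1 hl.2) hli]
      symm
      apply sum_subset_zero_on_sdiff
      · exact Finset.Icc_subset_Icc (by omega) (by omega)
      · intro j hj
        simp only [Finset.mem_Icc, Finset.mem_sdiff] at hj
        by_cases h : l ≤ j
        · rw [doc_of_gt A (by omega), zero_mul]
        · rw [if_neg h, mul_zero]
      · intro j hj
        rw [mem_Icc] at hj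
        rw [if_pos hj.1]
    · rw [if_neg (by omega)]
      apply sum_eq_zero
      intro j _
      by_cases h : l ≤ j
      · rw [doc_of_gt A (by omega), zero_mul]
      · rw [if_neg h, mul_zero]
  have hBT := mul_eq_one_comm.mp hTB
  have h := congrFun (congrFun hBT ⟨n, by simp [hkn]⟩) ⟨k, by simp [hkn]⟩
  rw [Matrix.mul_apply, Matrix.one_apply] at h
  simp only [T, B, Subtype.mk.injEq] at h
  rw [Finset.sum_coe_sort (Icc k n) (fun j => (if j ≤ n then A n j else 0) * doc A j k)] at h
  rw [← h]
  apply sum_congr rfl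
  intro j hj
  rw [mem_Icc] at hj
  rw [if_pos hj.2]

variable {A : ℕ → ℕ → ℝ} {N : ℕ}

/-- A lower triangular matrix with positive entries whose consecutive row quotients decrease
has an inverse with nonpositive off-diagonal entries. -/
theorem doc_nonpos (hpos : ∀ n k, 1 ≤ k → k ≤ n → n ≤ N → 0 < A n k)
    (hquot : ∀ n k j, 1 ≤ k → k < j → j ≤ n → n + 1 ≤ N →
      A n k * A (n + 1) j ≤ A (n + 1) k * A n j) :
    ∀ n k, 1 ≤ k → k < n → n ≤ N → doc A n k ≤ 0 := by
  intro n
  induction n using Nat.strong_induction_on with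
  | _ n ih =>
  intro k hk hkn hnN
  obtain ⟨m, rfl⟩ : ∃ m, n = m + 1 := ⟨n - 1, by omega⟩
  have hkm : k ≤ m := by omega
  have hne : ∀ i, k ≤ i → i ≤ m + 1 → A i i ≠ 0 := fun i h1 h2 =>
    (hpos i i (by omega) le_rfl (by omega)).ne'
  have h1 := sum_mul_doc A hne hkn.le
  have h0 := sum_mul_doc A (fun i a b => hne i a (by omega)) hkm
  rw [if_neg (by omega), Finset.sum_Icc_succ_top (by omega)] at h1
  have hmk := hpos m k hk hkm (by omega)
  have hmk' := hpos (m + 1) k hk (by omega) hnN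
  -- Compares row `m + 1` with row `m` of `A * doc = 1`. The terms `j = k` agree; for `j > k` the
  -- quotient inequality is reversed by `doc A j k ≤ 0`, the induction hypothesis. So the part of
  -- row `m + 1` without its last term is nonnegative, which forces that last term to be
  -- nonpositive.
  have hkey : A (m + 1) k * ∑ j ∈ Icc k m, A m j * doc A j k
      ≤ A m k * ∑ j ∈ Icc k m, A (m + 1) j * doc A j k := by
    rw [mul_sum, mul_sum]
    apply sum_le_sum
    intro j hj
    rw [mem_Icc] at hj
    rcases hj.1.eq_or_lt with rfl | hkj
    · exact le_of_eq (by ring)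
    · have := ih j (by omega) k hk hkj (by omega)
      have := mul_le_mul_of_nonpos_right (hquot m k j hk hkj hj.2 hnN) this
      linarith
  have h2 : 0 ≤ A (m + 1) k * ∑ j ∈ Icc k m, A m j * doc A j k := by
    rw [h0]; split_ifs <;> simp [hmk'.le]
  have h3 : 0 ≤ ∑ j ∈ Icc k m, A (m + 1) j * doc A j k :=
    nonneg_of_mul_nonneg_right (h2.trans hkey) hmk
  by_contra! hcon
  have := mul_pos (hpos (m + 1) (m + 1) (by omega) le_rfl hnN) hcon
  linarith

/-- In `0 = ∑ A n j * doc A j k`, replacing each `A n j` by the smallest one, `A n k`, can only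
increase the sum, since `doc A j k ≤ 0` for `j > k`. Hence `A n k * dcc A n k ≥ 0`. Equality would
kill every off-diagonal `doc` and leave the positive diagonal term alone. -/
theorem dcc_pos (hpos : ∀ n k, 1 ≤ k → k ≤ n → n ≤ N → 0 < A n k)
    (hrow : ∀ n k j, 1 ≤ k → k < j → j ≤ n → n ≤ N → A n k < A n j)
    (hdoc : ∀ n k, 1 ≤ k → k < n → n ≤ N → doc A n k ≤ 0)
    {n k : ℕ} (hk : 1 ≤ k) (hkn : k ≤ n) (hnN : n ≤ N) : 0 < dcc A n k := by
  have hne : ∀ i, k ≤ i → i ≤ n → A i i ≠ 0 := fun i h1 h2 =>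
    (hpos i i (by omega) le_rfl (by omega)).ne'
  have hkk : 0 < doc A k k := by
    rw [doc_self]; exact one_div_pos.mpr (hpos k k hk le_rfl (by omega))
  rcases hkn.eq_or_lt with rfl | hlt
  · simpa [dcc] using hkk
  have h1 := sum_mul_doc A hne hkn
  rw [if_neg hlt.ne'] at h1
  have hnk := hpos n k hk hkn hnN
  have hle : ∀ j ∈ Icc k n, A n j * doc A j k ≤ A n k * doc A j k := by
    intro j hj
    rw [mem_Icc] at hj
    rcases hj.1.eq_or_lt with rfl | hkj
    · exact le_rfl
    · exact mul_le_mul_of_nonpos_right (hrow n k j hk hkj hj.2 hnN).le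
        (hdoc j k hk hkj (by omega))
  by_contra! hcon
  have hsum : ∑ j ∈ Icc k n, A n k * doc A j k ≤ 0 := by
    rw [← mul_sum]; exact mul_nonpos_of_nonneg_of_nonpos hnk.le hcon
  have heq := (sum_eq_sum_iff_of_le hle).mp
    (le_antisymm (sum_le_sum hle) (by rw [h1]; exact hsum))
  have hzero : ∀ j, k < j → j ≤ n → doc A j k = 0 := by
    intro j hkj hjn
    have := heq j (by simp; omega)
    have h2 := hrow n k j hk hkj hjn hnN
    have h3 : (A n j - A n k) * doc A j k = 0 := by linarith
    rcases mul_eq_zero.mp h3 with h | h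
    · linarith
    · exact h
  rw [← Finset.insert_Icc_add_one_left_eq_Icc hkn, sum_insert (by simp), sum_eq_zero] at h1
  · have := mul_pos hnk hkk
    linarith
  · intro j hj
    rw [mem_Icc] at hj
    rw [hzero j (by omega) hj.2, mul_zero]

/-- The transposed argument, with `doc * A = 1` and columns in place of rows. -/
theorem rcc_pos (hpos : ∀ n k, 1 ≤ k → k ≤ n → n ≤ N → 0 < A n k)
    (hcol : ∀ n k j, 1 ≤ k → k ≤ j → j < n → n ≤ N → A n k < A j k)
    (hdoc : ∀ n k, 1 ≤ k → k < n → n ≤ N → doc A n k ≤ 0)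
    {n k : ℕ} (hk : 1 ≤ k) (hkn : k ≤ n) (hnN : n ≤ N) : 0 < rcc A n k := by
  have hnn : 0 < doc A n n := by
    rw [doc_self]; exact one_div_pos.mpr (hpos n n (by omega) le_rfl (by omega))
  rcases hkn.eq_or_lt with rfl | hlt
  · simpa [rcc] using hnn
  have h1 := sum_doc_mul A (hpos k k hk le_rfl (by omega)).ne' hkn
  rw [if_neg hlt.ne'] at h1
  have hnk := hpos n k hk hkn hnN
  have hle : ∀ j ∈ Icc k n, doc A n j * A j k ≤ doc A n j * A n k := by
    intro j hj
    rw [mem_Icc] at hj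
    rcases hj.2.eq_or_lt with rfl | hjn
    · exact le_rfl
    · exact mul_le_mul_of_nonpos_left (hcol n k j hk hj.1 hjn hnN).le
        (hdoc n j (by omega) hjn hnN)
  by_contra! hcon
  have hsum : ∑ j ∈ Icc k n, doc A n j * A n k ≤ 0 := by
    rw [← sum_mul]; exact mul_nonpos_of_nonpos_of_nonneg hcon hnk.le
  have heq := (sum_eq_sum_iff_of_le hle).mp
    (le_antisymm (sum_le_sum hle) (by rw [h1]; exact hsum))
  have hzero : ∀ j, k ≤ j → j < n → doc A n j = 0 := by
    intro j hkj hjn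
    have := heq j (by simp; omega)
    have h2 := hcol n k j hk hkj hjn hnN
    have h3 : doc A n j * (A j k - A n k) = 0 := by linarith
    rcases mul_eq_zero.mp h3 with h | h
    · exact h
    · linarith
  obtain ⟨m, rfl⟩ : ∃ m, n = m + 1 := ⟨n - 1, by omega⟩
  rw [Finset.sum_Icc_succ_top (by omega), sum_eq_zero] at h1
  · have := mul_pos hnn hnk
    linarith
  · intro j hj
    rw [mem_Icc] at hj
    rw [hzero j hj.1 (by omega), zero_mul]

theorem rcc_eq_add {n k : ℕ} (h : k ≤ n) : rcc A n k = doc A n k + rcc A n (k + 1) := by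
  rw [rcc, rcc, ← Finset.insert_Icc_add_one_left_eq_Icc h, sum_insert (by simp)]

theorem rcc_self (n : ℕ) : rcc A n n = doc A n n := by simp [rcc]

theorem dcc_succ {n k : ℕ} (h : k ≤ n) : dcc A (n + 1) k = dcc A n k + doc A (n + 1) k := by
  rw [dcc, dcc, Finset.sum_Icc_succ_top (by omega)]

theorem dcc_self (n : ℕ) : dcc A n n = doc A n n := by simp [dcc]

/-- Abel summation identity behind the discrete gradient structure. -/
theorem discrete_gradient_aux (P v : ℕ → ℝ) (n : ℕ) (hP : ∀ j, 1 ≤ j → j ≤ n + 1 → P j ≠ 0)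
    (hv : v 0 = 0) :
    2 * v (n + 1) * (∑ k ∈ Icc 1 (n + 1), P k * (v k - v (k - 1)))
        - (∑ k ∈ Icc 1 (n + 1), P k * (v k - v (k - 1))) ^ 2 / P (n + 1)
      = ∑ j ∈ Icc 1 n, (P j - P (j + 1)) * v j ^ 2 + P (n + 1) * v (n + 1) ^ 2
        + ∑ j ∈ Icc 1 n, (1 / P j - 1 / P (j + 1))
          * (∑ k ∈ Icc 1 j, P k * (v k - v (k - 1))) ^ 2 := by
  induction n with
  | zero =>
    have := hP 1 le_rfl le_rfl
    simp [hv]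
    field_simp
    ring
  | succ n ih =>
    have ih' := ih (fun j h1 h2 => hP j h1 (by omega))
    have h1 := hP (n + 1) (by omega) (by omega)
    have h2 := hP (n + 1 + 1) (by omega) (by omega)
    rw [Finset.sum_Icc_succ_top (a := 1) (b := n + 1) (by omega),
      Finset.sum_Icc_succ_top (b := n) (by omega) (fun j => (P j - P (j + 1)) * v j ^ 2),
      Finset.sum_Icc_succ_top (b := n) (by omega) (fun j => (1 / P j - 1 / P (j + 1))
          * (∑ k ∈ Icc 1 j, P k * (v k - v (k - 1))) ^ 2)]
    set S := ∑ k ∈ Icc 1 (n + 1), P k * (v k - v (k - 1))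
    rw [Nat.add_sub_cancel]
    have e : ∑ j ∈ Icc 1 n, (P j - P (j + 1)) * v j ^ 2
        + ∑ j ∈ Icc 1 n, (1 / P j - 1 / P (j + 1))
          * (∑ k ∈ Icc 1 j, P k * (v k - v (k - 1))) ^ 2
        = 2 * v (n + 1) * S - S ^ 2 / P (n + 1) - P (n + 1) * v (n + 1) ^ 2 := by linarith
    -- With `S'`, `P'`, `v'` at the new level, `2 v' S' - S'²/P' = P' v'² - (S' - P' v')²/P'`, and
    -- `S' - P' v' = S - P' v` depends on old `S`, `v` only.
    have e2 : 2 * v (n + 1 + 1) * (S + P (n + 1 + 1) * (v (n + 1 + 1) - v (n + 1)))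
        - (S + P (n + 1 + 1) * (v (n + 1 + 1) - v (n + 1))) ^ 2 / P (n + 1 + 1)
        = 2 * v (n + 1) * S - S ^ 2 / P (n + 1) - P (n + 1) * v (n + 1) ^ 2
        + (P (n + 1) - P (n + 1 + 1)) * v (n + 1) ^ 2 + P (n + 1 + 1) * v (n + 1 + 1) ^ 2
        + (1 / P (n + 1) - 1 / P (n + 1 + 1)) * S ^ 2 := by
      field_simp
      ring
    rw [e2]
    linarith

/-- Recovering `w` from `v = A w`, in terms of the right-complementary kernels. -/
theorem sum_rcc_mul_sub (hne : ∀ i, 1 ≤ i → i ≤ N → A i i ≠ 0) (w v : ℕ → ℝ)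
    (hv : ∀ j, v j = ∑ l ∈ Icc 1 j, A j l * w l) {n : ℕ} (h1 : 1 ≤ n) (hn : n ≤ N) :
    ∑ k ∈ Icc 1 n, rcc A n k * (v k - v (k - 1)) = w n := by
  have hv0 : v 0 = 0 := by rw [hv]; simp
  -- Summation by parts, using that consecutive `rcc` differ by `doc`; the boundary term at `m = n`
  -- is an empty sum.
  have habel : ∀ m, m ≤ n → ∑ k ∈ Icc 1 m, rcc A n k * (v k - v (k - 1))
      = ∑ j ∈ Icc 1 m, doc A n j * v j + rcc A n (m + 1) * v m := by
    intro m
    induction m with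
    | zero => simp [hv0]
    | succ m ih =>
      intro hm
      rw [Finset.sum_Icc_succ_top (by omega), Finset.sum_Icc_succ_top (by omega),
        ih (by omega), Nat.add_sub_cancel, rcc_eq_add hm]
      ring
  have hr : rcc A n (n + 1) = 0 := by simp [rcc]
  rw [habel n le_rfl, hr, zero_mul, add_zero]
  simp_rw [hv, mul_sum]
  have hswap : ∑ x ∈ Icc 1 n, ∑ i ∈ Icc 1 x, doc A n x * (A x i * w i)
      = ∑ i ∈ Icc 1 n, ∑ x ∈ Icc i n, doc A n x * (A x i * w i) := by
    apply sum_comm'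
    intro x y
    simp only [mem_Icc]
    omega
  rw [hswap]
  have : ∀ i ∈ Icc 1 n, ∑ x ∈ Icc i n, doc A n x * (A x i * w i)
      = if n = i then w i else 0 := by
    intro i hi
    rw [mem_Icc] at hi
    have := sum_doc_mul A (hne i hi.1 (by omega)) hi.2
    simp_rw [← mul_assoc]
    rw [← sum_mul, this]
    split_ifs <;> simp
  rw [sum_congr rfl this, sum_ite_eq, if_pos (by simp [h1])]

/-- The discrete gradient structure of a kernel whose right-complementary kernels do not vanish. -/
theorem discrete_gradient (hne : ∀ i, 1 ≤ i → i ≤ N → A i i ≠ 0) (w v : ℕ → ℝ)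
    (hv : ∀ j, v j = ∑ l ∈ Icc 1 j, A j l * w l) {n : ℕ} (hn : n + 1 ≤ N)
    (hr : ∀ j, 1 ≤ j → j ≤ n + 1 → rcc A (n + 1) j ≠ 0) :
    2 * v (n + 1) * w (n + 1) - A (n + 1) (n + 1) * w (n + 1) ^ 2
      = ∑ j ∈ Icc 1 (n + 1), dcc A (n + 1) j * v j ^ 2 - ∑ j ∈ Icc 1 n, dcc A n j * v j ^ 2
        + ∑ j ∈ Icc 1 n, (1 / rcc A (n + 1) j - 1 / rcc A (n + 1) (j + 1))
          * (∑ k ∈ Icc 1 j, rcc A (n + 1) k * (v k - v (k - 1))) ^ 2 := by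
  have hv0 : v 0 = 0 := by rw [hv]; simp
  -- With weights `rcc`, the full sum is `w (n + 1)` and the last weight is `1 / A (n + 1) (n + 1)`,
  -- so the quotient of squares is the diagonal term.
  have h := discrete_gradient_aux (rcc A (n + 1)) v n hr hv0
  rw [sum_rcc_mul_sub hne w v hv (by omega) hn, rcc_self, doc_self, div_div_eq_mul_div, div_one,
    mul_comm (w (n + 1) ^ 2)] at h
  rw [h, Finset.sum_Icc_succ_top (by omega), dcc_self, doc_self]
  congr 1
  rw [add_sub_right_comm, ← sum_sub_distrib]
  congr 1
  apply sum_congr rfl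
  intro j hj
  rw [mem_Icc] at hj
  -- Both increments, of `dcc` in the upper index and of `rcc` in the column, equal `doc A (n + 1)
  -- j`.
  rw [dcc_succ hj.2, rcc_eq_add (k := j) (by omega)]
  ring

end Kernels

/-! ### The function `rho`: concavity, symmetry and the step-ratio inequality. -/

section Rho

variable {β : ℝ}

theorem rho_zero (hβ0 : 0 < β) : rho β 0 = 0 := by
  simp [rho, Real.zero_rpow (by linarith : (1 + β) ≠ 0)]

theorem rho_one : rho β 1 = 2 * ((2 : ℝ) ^ β - 1) := by
  rw [rho, Real.one_rpow, show (1 + 1 : ℝ) = 2 by norm_num, Real.rpow_add (by norm_num),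
    Real.rpow_one]
  ring

theorem hasDerivAt_rho {z : ℝ} (hz : 0 < z) :
    HasDerivAt (rho β) ((1 + β) * ((z + 1) ^ β - z ^ β)) z := by
  have h1 : HasDerivAt (fun z : ℝ => (z + 1) ^ (1 + β)) (1 * (1 + β) * (z + 1) ^ (1 + β - 1)) z :=
    ((hasDerivAt_id z).add_const 1).rpow_const (Or.inl (by simp; linarith))
  have h2 : HasDerivAt (fun z : ℝ => z ^ (1 + β)) (1 * (1 + β) * z ^ (1 + β - 1)) z :=
    (hasDerivAt_id z).rpow_const (Or.inl hz.ne')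
  refine ((h1.sub h2).sub_const 1).congr_deriv ?_
  rw [add_sub_cancel_left]
  ring

theorem antitoneOn_rpow_sub (hβ0 : 0 < β) (hβ1 : β < 1) :
    AntitoneOn (fun z : ℝ => (z + 1) ^ β - z ^ β) (Set.Ioi 0) := by
  have hd : ∀ z : ℝ, 0 < z → HasDerivAt (fun z : ℝ => (z + 1) ^ β - z ^ β)
      (β * ((z + 1) ^ (β - 1) - z ^ (β - 1))) z := by
    intro z hz
    have h1 : HasDerivAt (fun z : ℝ => (z + 1) ^ β) (1 * β * (z + 1) ^ (β - 1)) z :=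
      ((hasDerivAt_id z).add_const 1).rpow_const (Or.inl (by simp; linarith))
    have h2 : HasDerivAt (fun z : ℝ => z ^ β) (1 * β * z ^ (β - 1)) z :=
      (hasDerivAt_id z).rpow_const (Or.inl hz.ne')
    exact (h1.sub h2).congr_deriv (by ring)
  apply antitoneOn_of_deriv_nonpos (convex_Ioi 0)
  · exact fun z hz => (hd z hz).continuousAt.continuousWithinAt
  · rw [interior_Ioi]
    exact fun z hz => (hd z hz).differentiableAt.differentiableWithinAt
  · rw [interior_Ioi]
    intro z hz
    rw [(hd z hz).deriv]
    have := Real.rpow_le_rpow_of_nonpos hz (by linarith : z ≤ z + 1) (by linarith : β - 1 ≤ 0)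
    exact mul_nonpos_of_nonneg_of_nonpos hβ0.le (by linarith)

theorem concaveOn_rho (hβ0 : 0 < β) (hβ1 : β < 1) : ConcaveOn ℝ (Set.Ici 0) (rho β) := by
  apply AntitoneOn.concaveOn_of_deriv (convex_Ici 0)
  · have : Continuous (rho β) := by
      unfold rho
      exact (((continuous_id.add continuous_const).rpow_const fun _ => Or.inr (by linarith)).sub
        (continuous_id.rpow_const fun _ => Or.inr (by linarith))).sub continuous_const
    exact this.continuousOn
  · rw [interior_Ici]
    exact fun z hz => (hasDerivAt_rho hz).differentiableAt.differentiableWithinAt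
  · rw [interior_Ici]
    intro x hx y hy hxy
    rw [(hasDerivAt_rho hx).deriv, (hasDerivAt_rho hy).deriv]
    exact mul_le_mul_of_nonneg_left (antitoneOn_rpow_sub hβ0 hβ1 hx hy hxy) (by linarith)

theorem rpow_one_add_eq {z : ℝ} (hz : 0 ≤ z) (hβ0 : 0 < β) : z ^ (1 + β) = z * z ^ β := by
  rw [Real.rpow_add_of_nonneg hz zero_le_one hβ0.le, Real.rpow_one]

theorem rho_pos (hβ0 : 0 < β) {z : ℝ} (hz : 0 < z) : 0 < rho β z := by
  rw [rho, rpow_one_add_eq (by linarith) hβ0, rpow_one_add_eq hz.le hβ0]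
  have h1 : z ^ β < (z + 1) ^ β := Real.rpow_lt_rpow hz.le (by linarith) hβ0
  have h2 : 1 ≤ (z + 1) ^ β := Real.one_le_rpow (by linarith) hβ0.le
  have := mul_lt_mul_of_pos_left h1 hz
  linarith

/-- Split `ρ(z) = z ((z+1)^β - z^β) + ((z+1)^β - 1)`; subadditivity bounds the first part by `z`,
Bernoulli the second by `β z`. -/
theorem rho_lt_two_mul (hβ0 : 0 < β) (hβ1 : β < 1) {z : ℝ} (hz : 0 < z) : rho β z < 2 * z := by
  rw [rho, rpow_one_add_eq (by linarith) hβ0, rpow_one_add_eq hz.le hβ0]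
  have h1 : (z + 1) ^ β ≤ 1 + β * z := by
    rw [add_comm]
    exact rpow_one_add_le_one_add_mul_self (by linarith) hβ0.le hβ1.le
  have h2 : (z + 1) ^ β ≤ z ^ β + 1 := by
    have := Real.rpow_add_le_add_rpow hz.le zero_le_one hβ0.le hβ1.le
    simpa using this
  have h3 := mul_le_mul_of_nonneg_left h2 hz.le
  have h4 := mul_lt_mul_of_pos_right hβ1 hz
  linarith

/-- Concavity together with `ρ(0) = 0`: `ρ(z)/z` is nonincreasing. -/
theorem mul_rho_le_rho_mul (hβ0 : 0 < β) (hβ1 : β < 1) {c z : ℝ} (hc0 : 0 ≤ c) (hc1 : c ≤ 1)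
    (hz : 0 ≤ z) : c * rho β z ≤ rho β (c * z) := by
  have := (concaveOn_rho hβ0 hβ1).2 (Set.mem_Ici.mpr hz) (Set.mem_Ici.mpr le_rfl) hc0
    (sub_nonneg.mpr hc1) (by ring)
  simpa [rho_zero hβ0] using this

theorem rho_eq_rpow_mul_rho_inv {z : ℝ} (hz : 0 < z) :
    rho β z = z ^ (1 + β) * rho β z⁻¹ := by
  have h : z * (z⁻¹ + 1) = z + 1 := by field_simp; ring
  rw [rho, rho, mul_sub, mul_sub, ← Real.mul_rpow hz.le (by positivity),
    ← Real.mul_rpow hz.le (by positivity), h, mul_inv_cancel₀ hz.ne', Real.one_rpow]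
  ring

/-- By the symmetry `z ↔ 1/z`, `ρ(z)/z^β` is the slope `ρ(x)/x` at `x = 1/z`, hence nondecreasing in
`z`. -/
theorem rpow_mul_rho_le (hβ0 : 0 < β) (hβ1 : β < 1) {c z : ℝ} (hc : 1 ≤ c) (hz : 0 < z) :
    c ^ β * rho β z ≤ rho β (c * z) := by
  have hc0 : 0 < c := by linarith
  rw [rho_eq_rpow_mul_rho_inv hz, rho_eq_rpow_mul_rho_inv (mul_pos hc0 hz),
    Real.mul_rpow hc0.le hz.le, rpow_one_add_eq hc0.le hβ0, mul_inv]
  have h := mul_rho_le_rho_mul hβ0 hβ1 (inv_nonneg.mpr hc0.le) (inv_le_one_of_one_le₀ hc)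
    (inv_nonneg.mpr hz.le)
  calc c ^ β * (z ^ (1 + β) * rho β z⁻¹)
      = c * c ^ β * z ^ (1 + β) * (c⁻¹ * rho β z⁻¹) := by field_simp
    _ ≤ _ := mul_le_mul_of_nonneg_left h (by positivity)

/-- With `x = 1/y` the claim is `(1+x)^β (1-x) ≤ 1 - x^(1+β)`. Bernoulli bounds the left side by
`(1+βx)(1-x) = 1 - (1-β)x - βx²`, and weighted AM-GM on `x` and `x²` gives `x^(1+β) ≤ (1-β)x + βx²`.
-/
theorem rho_le_two_mul (hβ0 : 0 < β) (hβ1 : β < 1) {y : ℝ} (hy : 1 ≤ y) :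
    rho β y ≤ 2 * ((1 + y) ^ β - 1) := by
  have hy0 : 0 < y := by linarith
  rw [rho_eq_rpow_mul_rho_inv hy0]
  set x := y⁻¹ with hx
  have hx0 : 0 < x := inv_pos.mpr hy0
  have hx1 : x ≤ 1 := inv_le_one_of_one_le₀ hy
  have hyx : y = x⁻¹ := by rw [hx, inv_inv]
  have h1 : (1 + x) ^ β ≤ 1 + β * x :=
    rpow_one_add_le_one_add_mul_self (by linarith) hβ0.le hβ1.le
  have h2 : x ^ (1 + β) ≤ (1 - β) * x + β * x ^ 2 := by
    have := Real.geom_mean_le_arith_mean2_weighted (sub_nonneg.mpr hβ1.le) hβ0.le hx0.le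
      (sq_nonneg x) (by ring)
    refine le_trans (le_of_eq ?_) this
    rw [← Real.rpow_natCast, ← Real.rpow_mul hx0.le, ← Real.rpow_add hx0]
    congr 1
    push_cast
    ring
  have h3 : (1 + x) ^ β * (1 - x) ≤ 1 - x ^ (1 + β) := by
    have := mul_le_mul_of_nonneg_right h1 (sub_nonneg.mpr hx1)
    nlinarith
  have e1 : (1 + y) ^ β = y ^ β * (1 + x) ^ β := by
    rw [← Real.mul_rpow hy0.le (by positivity)]
    congr 1
    rw [hx]; field_simp; ring
  have e2 : y ^ β * x ^ (1 + β) = x := by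
    rw [rpow_one_add_eq hx0.le hβ0, mul_left_comm, ← Real.mul_rpow hy0.le hx0.le, hx,
      mul_inv_cancel₀ hy0.ne', Real.one_rpow, mul_one]
  have e3 : rho β x = (1 + x) * (1 + x) ^ β - x ^ (1 + β) - 1 := by
    rw [rho, add_comm x 1, rpow_one_add_eq (z := 1 + x) (by positivity) hβ0]
  have e4 : y * x = 1 := mul_inv_cancel₀ hy0.ne'
  rw [rpow_one_add_eq hy0.le hβ0, e1, e3]
  have h4 := mul_le_mul_of_nonneg_left h3 (by positivity : 0 ≤ y * y ^ β)
  have e5 : y * y ^ β * ((1 + x) ^ β * (1 - x)) = y * y ^ β * (1 + x) ^ β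
      - y ^ β * (1 + x) ^ β := by
    linear_combination (-(y ^ β * (1 + x) ^ β)) * e4
  have e6 : y * y ^ β * (1 - x ^ (1 + β)) = y * y ^ β - 1 := by
    linear_combination (-y) * e2 - e4
  have e7 : y * y ^ β * ((1 + x) * (1 + x) ^ β - x ^ (1 + β) - 1) =
      y * y ^ β * (1 + x) ^ β + y ^ β * (1 + x) ^ β - 1 - y * y ^ β := by
    linear_combination (y ^ β * (1 + x) ^ β) * e4 - y * e2 - e4
  rw [e7]
  linarith

/-- The step-ratio constraint in the form in which it enters the kernel inequalities. -/
theorem rho_mul_rho_le (hβ0 : 0 < β) (hβ1 : β < 1) {r y : ℝ} (hr : 0 < r) (hy : 0 < y)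
    (h : rStar β r ≤ y) : rho β r * rho β y ≤ 2 * (rho β (r + r * y) - rho β r) := by
  have hρ := rho_pos hβ0 hr
  -- For `y ≥ 1` the inequality holds without the constraint. For `y ≤ 1`, `r + r y` lies between
  -- `r` and `2 r`, so concavity bounds the right side below by its chord, while `ρ(y) ≤ y^β ρ(1)`
  -- with `ρ(1) = 2 (2^β - 1)`; what remains is the constraint raised to the power `1 - β`.
  rcases le_total 1 y with hy1 | hy1
  · have h1 := rpow_mul_rho_le hβ0 hβ1 (by linarith : 1 ≤ 1 + y) hr
    have h2 := mul_le_mul_of_nonneg_left (rho_le_two_mul hβ0 hβ1 hy1) hρ.le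
    rw [show (1 + y) * r = r + r * y by ring] at h1
    linarith
  · have h2 : (1 : ℝ) < 2 ^ β := Real.one_lt_rpow (by norm_num) hβ0
    have hD : 0 < rho β (2 * r) - rho β r := by
      have := rpow_mul_rho_le hβ0 hβ1 (by norm_num : (1 : ℝ) ≤ 2) hr
      nlinarith
    have hq : ((2 : ℝ) ^ β - 1) * rho β r / (rho β (2 * r) - rho β r) ≤ y ^ (1 - β) := by
      have hq0 : 0 ≤ ((2 : ℝ) ^ β - 1) * rho β r / (rho β (2 * r) - rho β r) :=
        div_nonneg (mul_nonneg (by linarith) hρ.le) hD.le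
      have := Real.rpow_le_rpow (Real.rpow_nonneg hq0 _) h (by linarith : 0 ≤ 1 - β)
      rwa [← Real.rpow_mul hq0, one_div_mul_cancel (by linarith), Real.rpow_one] at this
    rw [div_le_iff₀ hD] at hq
    have hconc : y * (rho β (2 * r) - rho β r) ≤ rho β (r + r * y) - rho β r := by
      have := (concaveOn_rho hβ0 hβ1).2 (Set.mem_Ici.mpr (by positivity : 0 ≤ 2 * r))
        (Set.mem_Ici.mpr hr.le) hy.le (sub_nonneg.mpr hy1) (by ring)
      simp only [smul_eq_mul] at this
      rw [show y * (2 * r) + (1 - y) * r = r + r * y by ring] at this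
      linarith
    have hy2 : rho β y ≤ y ^ β * rho β 1 := by
      have h3 := rpow_mul_rho_le hβ0 hβ1 ((one_le_inv₀ hy).mpr hy1) hy
      rw [inv_mul_cancel₀ hy.ne', Real.inv_rpow hy.le, inv_mul_le_iff₀ (by positivity)] at h3
      exact h3
    have e : y ^ β * y ^ (1 - β) = y := by
      rw [← Real.rpow_add hy, add_sub_cancel, Real.rpow_one]
    calc rho β r * rho β y ≤ rho β r * (y ^ β * rho β 1) := mul_le_mul_of_nonneg_left hy2 hρ.le
      _ = 2 * (y ^ β * (((2 : ℝ) ^ β - 1) * rho β r)) := by rw [rho_one]; ring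
      _ ≤ 2 * (y ^ β * (y ^ (1 - β) * (rho β (2 * r) - rho β r))) := by gcongr
      _ = 2 * (y * (rho β (2 * r) - rho β r)) := by rw [← mul_assoc (y ^ β), e]
      _ ≤ _ := by linarith

end Rho
-- Integrals of the weakly singular kernel over rectangular cells.
section CellIntegrals

variable {β : ℝ}

theorem intervalIntegrable_rpow_const_sub (hβ0 : 0 < β) (x a b : ℝ) :
    IntervalIntegrable (fun s => (x - s) ^ (β - 1)) volume a b := by
  have := (intervalIntegral.intervalIntegrable_rpow' (a := x - a) (b := x - b)
    (by linarith : -1 < β - 1)).comp_sub_left x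
  simpa using this

theorem integral_rpow_const_sub (hβ0 : 0 < β) (x a b : ℝ) :
    ∫ s in a..b, (x - s) ^ (β - 1) = ((x - a) ^ β - (x - b) ^ β) / β := by
  rw [intervalIntegral.integral_comp_sub_left (fun z => z ^ (β - 1)) x,
    integral_rpow (Or.inl (by linarith)), sub_add_cancel]

theorem integral_omega (hβ0 : 0 < β) (x a b : ℝ) :
    ∫ s in a..b, omega β (x - s) = ((x - a) ^ β - (x - b) ^ β) / (β * Real.Gamma β) := by
  unfold omega
  rw [intervalIntegral.integral_div, integral_rpow_const_sub hβ0, div_div]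

theorem continuous_rpow_sub_const (hβ0 : 0 < β) (a : ℝ) : Continuous fun x : ℝ => (x - a) ^ β :=
  (continuous_id.sub continuous_const).rpow_const fun _ => Or.inr hβ0.le

theorem integral_rpow_sub_const (hβ0 : 0 < β) (a c d : ℝ) :
    ∫ x in c..d, (x - a) ^ β = ((d - a) ^ (1 + β) - (c - a) ^ (1 + β)) / (1 + β) := by
  rw [intervalIntegral.integral_comp_sub_right (fun z => z ^ β) a,
    integral_rpow (Or.inl (by linarith)), add_comm β]

/-- Up to the factor `β (1 + β)`, the integral of `(x - s)^(β-1)` over the cell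
`a < s < b`, `c < x < d`. -/
noncomputable def cellInt (β a b c d : ℝ) : ℝ :=
  (d - a) ^ (1 + β) - (c - a) ^ (1 + β) - (d - b) ^ (1 + β) + (c - b) ^ (1 + β)

theorem integral_rpow_sub_rpow (hβ0 : 0 < β) (a b c d : ℝ) :
    ∫ x in c..d, ((x - a) ^ β - (x - b) ^ β) = cellInt β a b c d / (1 + β) := by
  rw [intervalIntegral.integral_sub, integral_rpow_sub_const hβ0, integral_rpow_sub_const hβ0,
    cellInt]
  · ring
  · exact (continuous_rpow_sub_const hβ0 a).intervalIntegrable _ _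
  · exact (continuous_rpow_sub_const hβ0 b).intervalIntegrable _ _

/-- Time reversal exchanges source and target intervals, so each row estimate also yields a column
estimate. -/
theorem cellInt_neg (a b c d : ℝ) : cellInt β (-d) (-c) (-b) (-a) = cellInt β a b c d := by
  simp only [cellInt, neg_sub_neg]
  ring

theorem cellInt_pos (hβ0 : 0 < β) {a b c d : ℝ} (hab : a < b) (hbc : b ≤ c) (hcd : c < d) :
    0 < cellInt β a b c d := by
  have h : 0 < ∫ x in c..d, ((x - a) ^ β - (x - b) ^ β) := by
    apply intervalIntegral.intervalIntegral_pos_of_pos_on _ _ hcd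
    · exact ((continuous_rpow_sub_const hβ0 a).sub
        (continuous_rpow_sub_const hβ0 b)).intervalIntegrable _ _
    · intro x hx
      exact sub_pos.mpr (Real.rpow_lt_rpow (by linarith [hx.1]) (by linarith) hβ0)
  rw [integral_rpow_sub_rpow hβ0] at h
  exact (div_pos_iff_of_pos_right (by linarith)).mp h

/-- The mean over a cell increases as the source interval moves to the next one. -/
theorem cellInt_div_lt (hβ0 : 0 < β) (hβ1 : β < 1) {a b e c d : ℝ} (hab : a < b) (hbe : b < e)
    (hec : e ≤ c) (hcd : c < d) :
    cellInt β a b c d / (b - a) < cellInt β b e c d / (e - b) := by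
  have hc1 := continuous_rpow_sub_const hβ0 a
  have hc2 := continuous_rpow_sub_const hβ0 b
  have hc3 := continuous_rpow_sub_const hβ0 e
  have h : 0 < ∫ x in c..d, (((x - b) ^ β - (x - e) ^ β) / (e - b)
      - ((x - a) ^ β - (x - b) ^ β) / (b - a)) := by
    apply intervalIntegral.intervalIntegral_pos_of_pos_on _ _ hcd
    · exact (((hc2.sub hc3).div_const _).sub ((hc1.sub hc2).div_const _)).intervalIntegrable _ _
    · intro x hx
      -- Pointwise in `x`, the two means are slopes of the strictly concave `z ^ β` on adjacent
      -- intervals.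
      have := (Real.strictConcaveOn_rpow hβ0 hβ1).slope_anti_adjacent
        (x := x - e) (y := x - b) (z := x - a) (Set.mem_Ici.mpr (by linarith [hx.1]))
        (Set.mem_Ici.mpr (by linarith [hx.1])) (by linarith) (by linarith)
      rw [sub_sub_sub_cancel_left, sub_sub_sub_cancel_left] at this
      exact sub_pos.mpr this
  rw [intervalIntegral.integral_sub, intervalIntegral.integral_div, intervalIntegral.integral_div,
    integral_rpow_sub_rpow hβ0, integral_rpow_sub_rpow hβ0, div_right_comm, div_right_comm _ (1 + β),
    ← sub_div] at h
  · have := (div_pos_iff_of_pos_right (by linarith : 0 < 1 + β)).mp h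
    linarith
  · exact ((hc2.sub hc3).div_const _).intervalIntegrable _ _
  · exact ((hc1.sub hc2).div_const _).intervalIntegrable _ _

theorem intervalIntegral_mul_le_mul {f g : ℝ → ℝ} {a b p q : ℝ} (hab : a ≤ b)
    (hf : IntervalIntegrable f volume a b) (hg : IntervalIntegrable g volume a b)
    (h : ∀ x ∈ Set.Ioo a b, f x * p ≤ g x * q) :
    (∫ x in a..b, f x) * p ≤ (∫ x in a..b, g x) * q := by
  rw [← intervalIntegral.integral_mul_const, ← intervalIntegral.integral_mul_const]
  exact intervalIntegral.integral_mono_on_of_le_Ioo hab (hf.mul_const p) (hg.mul_const q) h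

/-- The negative power reverses `(x'-s)(x-s') ≤ (x-s)(x'-s')`, whose difference is `(s'-s)(x'-x)`.
The next two lemmas integrate this over both source variables and then both target variables. -/
theorem rpow_mul_rpow_le (hβ1 : β < 1) {s s' x x' : ℝ} (hs : s ≤ s') (hsx : s' < x)
    (hx : x ≤ x') :
    (x - s) ^ (β - 1) * (x' - s') ^ (β - 1) ≤ (x' - s) ^ (β - 1) * (x - s') ^ (β - 1) := by
  have h1 : 0 < x - s := by linarith
  have h2 : 0 < x' - s' := by linarith
  have h3 : 0 < x' - s := by linarith
  have h4 : 0 < x - s' := by linarith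
  rw [← Real.mul_rpow h1.le h2.le, ← Real.mul_rpow h3.le h4.le]
  apply Real.rpow_le_rpow_of_nonpos (mul_pos h3 h4) _ (by linarith)
  nlinarith [mul_nonneg (sub_nonneg.mpr hs) (sub_nonneg.mpr hx)]

theorem rpow_sub_rpow_mul_le (hβ0 : 0 < β) (hβ1 : β < 1) {a b a' b' x x' : ℝ} (hab : a < b)
    (hb : b ≤ a') (hab' : a' < b') (hbx : b' ≤ x) (hx : x ≤ x') :
    ((x - a) ^ β - (x - b) ^ β) * ((x' - a') ^ β - (x' - b') ^ β)
      ≤ ((x' - a) ^ β - (x' - b) ^ β) * ((x - a') ^ β - (x - b') ^ β) := by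
  have h1 : ∀ s' ∈ Set.Ioo a' b', (x' - s') ^ (β - 1) * ((x - a) ^ β - (x - b) ^ β)
      ≤ (x - s') ^ (β - 1) * ((x' - a) ^ β - (x' - b) ^ β) := by
    intro s' hs'
    have := intervalIntegral_mul_le_mul hab.le (intervalIntegrable_rpow_const_sub hβ0 x a b)
      (intervalIntegrable_rpow_const_sub hβ0 x' a b) (p := (x' - s') ^ (β - 1))
      (q := (x - s') ^ (β - 1)) (fun s hs => rpow_mul_rpow_le hβ1
        (by linarith [hs.2, hs'.1]) (by linarith [hs'.2]) hx)
    rw [integral_rpow_const_sub hβ0, integral_rpow_const_sub hβ0, div_mul_eq_mul_div,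
      div_mul_eq_mul_div, div_le_div_iff_of_pos_right hβ0] at this
    linarith
  have := intervalIntegral_mul_le_mul hab'.le (intervalIntegrable_rpow_const_sub hβ0 x' a' b')
    (intervalIntegrable_rpow_const_sub hβ0 x a' b') h1
  rw [integral_rpow_const_sub hβ0, integral_rpow_const_sub hβ0, div_mul_eq_mul_div,
    div_mul_eq_mul_div, div_le_div_iff_of_pos_right hβ0] at this
  linarith

theorem cellInt_mul_le (hβ0 : 0 < β) (hβ1 : β < 1) {a b a' b' c d c' d' : ℝ} (hab : a < b)
    (hb : b ≤ a') (hab' : a' < b') (hbc : b' ≤ c) (hcd : c < d) (hd : d ≤ c') (hcd' : c' < d') :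
    cellInt β a b c d * cellInt β a' b' c' d' ≤ cellInt β a b c' d' * cellInt β a' b' c d := by
  have hcont : ∀ a b : ℝ, Continuous fun x : ℝ => (x - a) ^ β - (x - b) ^ β := fun a b =>
    (continuous_rpow_sub_const hβ0 a).sub (continuous_rpow_sub_const hβ0 b)
  have hβ : (0 : ℝ) < 1 + β := by linarith
  have h1 : ∀ x ∈ Set.Ioo c d, ((x - a) ^ β - (x - b) ^ β) * cellInt β a' b' c' d'
      ≤ ((x - a') ^ β - (x - b') ^ β) * cellInt β a b c' d' := by
    intro x hx
    have := intervalIntegral_mul_le_mul hcd'.le ((hcont a' b').intervalIntegrable c' d')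
      ((hcont a b).intervalIntegrable c' d') (p := (x - a) ^ β - (x - b) ^ β)
      (q := (x - a') ^ β - (x - b') ^ β) (fun x' hx' => by
        rw [mul_comm]
        exact rpow_sub_rpow_mul_le hβ0 hβ1 hab hb hab' (by linarith [hx.1])
          (by linarith [hx.2, hx'.1]))
    rw [integral_rpow_sub_rpow hβ0, integral_rpow_sub_rpow hβ0, div_mul_eq_mul_div,
      div_mul_eq_mul_div, div_le_div_iff_of_pos_right hβ] at this
    linarith
  have := intervalIntegral_mul_le_mul hcd.le ((hcont a b).intervalIntegrable c d)
    ((hcont a' b').intervalIntegrable c d) h1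
  rw [integral_rpow_sub_rpow hβ0, integral_rpow_sub_rpow hβ0, div_mul_eq_mul_div,
    div_mul_eq_mul_div, div_le_div_iff_of_pos_right hβ] at this
  linarith

theorem rpow_mul_rho_div {p q : ℝ} (hp : 0 < p) (hq : 0 ≤ q) :
    p ^ (1 + β) * rho β (q / p) = (p + q) ^ (1 + β) - q ^ (1 + β) - p ^ (1 + β) := by
  have h : p * (q / p + 1) = p + q := by field_simp; ring
  rw [rho, mul_sub, mul_sub, ← Real.mul_rpow hp.le (by positivity),
    ← Real.mul_rpow hp.le (by positivity), h, mul_div_cancel₀ _ hp.ne', mul_one]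

theorem cellInt_adjacent (a b d : ℝ) (hβ0 : 0 < β) :
    cellInt β a b b d = (d - a) ^ (1 + β) - (d - b) ^ (1 + β) - (b - a) ^ (1 + β) := by
  rw [cellInt, sub_self b, Real.zero_rpow (by linarith)]
  ring

/-- The right side is the doubled diagonal entry and the claim is `ρ(z) < 2z`. Since `ρ(z)/z → 1 +
β` as `z → 0`, an undoubled diagonal would not do. -/
theorem cellInt_adjacent_lt (hβ0 : 0 < β) (hβ1 : β < 1) {a b d : ℝ} (hab : a < b) (hbd : b < d) :
    cellInt β a b b d / ((d - b) * (b - a)) < 2 * ((b - a) ^ (1 + β) / (b - a) ^ 2) := by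
  have hp : 0 < b - a := by linarith
  have hq : 0 < d - b := by linarith
  have h := rho_lt_two_mul hβ0 hβ1 (div_pos hq hp)
  have hpow : 0 < (b - a) ^ (1 + β) := Real.rpow_pos_of_pos hp _
  have e : cellInt β a b b d = (b - a) ^ (1 + β) * rho β ((d - b) / (b - a)) := by
    rw [rpow_mul_rho_div hp hq.le, cellInt_adjacent _ _ _ hβ0,
      show b - a + (d - b) = d - a by ring]
  rw [e, div_lt_iff₀ (by positivity)]
  calc _ < (b - a) ^ (1 + β) * (2 * ((d - b) / (b - a))) := mul_lt_mul_of_pos_left h hpow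
    _ = _ := by field_simp

end CellIntegrals

/-! ### Closed forms, monotonicity and quotient inequalities of the kernels. -/

section Mesh

variable {β : ℝ} {N : ℕ} {t : ℕ → ℝ}

theorem IsMesh.lt (ht : IsMesh N t) {i j : ℕ} (hij : i < j) (hj : j ≤ N) : t i < t j := by
  induction j, hij using Nat.le_induction with
  | base => simpa using ht.2 (i + 1) (by omega) hj
  | succ j hij ih =>
    have := ht.2 (j + 1) (by omega) hj
    rw [Nat.add_sub_cancel] at this
    exact (ih (by omega)).trans this

theorem IsMesh.le (ht : IsMesh N t) {i j : ℕ} (hij : i ≤ j) (hj : j ≤ N) : t i ≤ t j := by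
  rcases hij.eq_or_lt with rfl | h
  · exact le_rfl
  · exact (ht.lt h hj).le

theorem IsMesh.step_pos (ht : IsMesh N t) {k : ℕ} (hk : 1 ≤ k) (hkN : k ≤ N) : 0 < step t k :=
  sub_pos.mpr (ht.2 k hk hkN)

theorem integral_integral_omega (hβ0 : 0 < β) (a b c d : ℝ) :
    ∫ x in c..d, ∫ s in a..b, omega β (x - s)
      = cellInt β a b c d / (β * (1 + β) * Real.Gamma β) := by
  simp_rw [integral_omega hβ0]
  rw [intervalIntegral.integral_div, integral_rpow_sub_rpow hβ0, div_div]
  congr 1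
  ring

theorem kernel_of_lt (hβ0 : 0 < β) (ht : IsMesh N t) {n k : ℕ} (hkn : k < n) (hn : n ≤ N) :
    kernel β t n k = cellInt β (t (k - 1)) (t k) (t (n - 1)) (t n) / (step t n * step t k)
      / (β * (1 + β) * Real.Gamma β) := by
  have h1 : t (n - 1) ≤ t n := ht.le (by omega) hn
  have : ∫ x in t (n - 1)..t n, ∫ s in t (k - 1)..min x (t k), omega β (x - s)
      = ∫ x in t (n - 1)..t n, ∫ s in t (k - 1)..t k, omega β (x - s) := by
    apply intervalIntegral.integral_congr
    intro x hx
    rw [Set.uIcc_of_le h1] at hx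
    have : t k ≤ x := (ht.le (by omega) (by omega)).trans hx.1
    simp only [min_eq_right this]
  rw [kernel, this, integral_integral_omega hβ0]
  ring

theorem kernel_self (hβ0 : 0 < β) (ht : IsMesh N t) {n : ℕ} (hn : n ≤ N) :
    kernel β t n n = step t n ^ (1 + β) / step t n ^ 2 / (β * (1 + β) * Real.Gamma β) := by
  have h1 : t (n - 1) ≤ t n := ht.le (by omega) hn
  have : ∫ x in t (n - 1)..t n, ∫ s in t (n - 1)..min x (t n), omega β (x - s)
      = ∫ x in t (n - 1)..t n, (x - t (n - 1)) ^ β / (β * Real.Gamma β) := by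
    apply intervalIntegral.integral_congr
    intro x hx
    rw [Set.uIcc_of_le h1] at hx
    simp only [min_eq_left hx.2, integral_omega hβ0, sub_self, Real.zero_rpow hβ0.ne', sub_zero]
  rw [kernel, this, intervalIntegral.integral_div, integral_rpow_sub_const hβ0, sub_self,
    Real.zero_rpow (by linarith), sub_zero, ← step, div_div, ← pow_two, one_div_mul_eq_div,
    div_right_comm, mul_left_comm, mul_assoc]

theorem kernelConst_pos (hβ0 : 0 < β) : 0 < β * (1 + β) * Real.Gamma β := by
  have := Real.Gamma_pos_of_pos hβ0
  positivity

theorem modKernel_of_lt (hβ0 : 0 < β) (ht : IsMesh N t) {n k : ℕ} (hkn : k < n) (hn : n ≤ N) :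
    modKernel β t n k = cellInt β (t (k - 1)) (t k) (t (n - 1)) (t n) / (step t n * step t k)
      / (β * (1 + β) * Real.Gamma β) := by
  rw [modKernel, if_neg hkn.ne, kernel_of_lt hβ0 ht hkn hn]

theorem modKernel_self (hβ0 : 0 < β) (ht : IsMesh N t) {n : ℕ} (hn : n ≤ N) :
    modKernel β t n n = 2 * (step t n ^ (1 + β) / step t n ^ 2)
      / (β * (1 + β) * Real.Gamma β) := by
  rw [modKernel, if_pos rfl, kernel_self hβ0 ht hn, mul_div_assoc]

theorem modKernel_pos (hβ0 : 0 < β) (ht : IsMesh N t) :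
    ∀ n k, 1 ≤ k → k ≤ n → n ≤ N → 0 < modKernel β t n k := by
  intro n k hk hkn hn
  have hκ := kernelConst_pos hβ0
  have h1 := ht.step_pos hk (by omega)
  have h2 := ht.step_pos (by omega : 1 ≤ n) hn
  rcases hkn.eq_or_lt with rfl | h
  · rw [modKernel_self hβ0 ht hn]
    have := Real.rpow_pos_of_pos h1 (1 + β)
    positivity
  · rw [modKernel_of_lt hβ0 ht h hn]
    have := cellInt_pos hβ0 (ht.2 k hk (by omega)) (ht.le (by omega : k ≤ n - 1) (by omega))
      (ht.2 n (by omega) hn)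
    positivity

theorem modKernel_lt_succ_right (hβ0 : 0 < β) (hβ1 : β < 1) (ht : IsMesh N t) {n k : ℕ}
    (hk : 1 ≤ k) (hkn : k + 1 ≤ n) (hn : n ≤ N) : modKernel β t n k < modKernel β t n (k + 1) := by
  have hκ := kernelConst_pos hβ0
  have hab := ht.2 k hk (by omega)
  have hbe : t k < t (k + 1) := ht.lt (by omega) (by omega)
  rcases hkn.eq_or_lt with rfl | h
  · rw [modKernel_self hβ0 ht hn, modKernel_of_lt hβ0 ht (by omega) hn,
      div_lt_div_iff_of_pos_right hκ, Nat.add_sub_cancel, step, step, Nat.add_sub_cancel]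
    -- The diagonal cell belongs to the later interval, so the estimate is applied in reversed time.
    have := cellInt_adjacent_lt hβ0 hβ1 (neg_lt_neg hbe) (neg_lt_neg hab)
    rwa [cellInt_neg, neg_sub_neg, neg_sub_neg, mul_comm (t k - t (k - 1))] at this
  · rw [modKernel_of_lt hβ0 ht h hn, modKernel_of_lt hβ0 ht (by omega) hn,
      div_lt_div_iff_of_pos_right hκ, Nat.add_sub_cancel, mul_comm (step t n),
      mul_comm (step t n), ← div_div, ← div_div,
      div_lt_div_iff_of_pos_right (ht.step_pos (by omega : 1 ≤ n) hn), step, step,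
      Nat.add_sub_cancel]
    exact cellInt_div_lt hβ0 hβ1 hab hbe (ht.le (by omega) (by omega)) (ht.2 n (by omega) hn)

theorem modKernel_lt_right (hβ0 : 0 < β) (hβ1 : β < 1) (ht : IsMesh N t) :
    ∀ n k j, 1 ≤ k → k < j → j ≤ n → n ≤ N → modKernel β t n k < modKernel β t n j := by
  intro n k j hk hkj
  induction j, hkj using Nat.le_induction with
  | base => exact fun hj hn => modKernel_lt_succ_right hβ0 hβ1 ht hk hj hn
  | succ j hkj ih =>
    exact fun hj hn => (ih (by omega) hn).trans
      (modKernel_lt_succ_right hβ0 hβ1 ht (by omega) hj hn)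

theorem modKernel_succ_left_lt (hβ0 : 0 < β) (hβ1 : β < 1) (ht : IsMesh N t) {n k : ℕ}
    (hk : 1 ≤ k) (hkn : k ≤ n) (hn : n + 1 ≤ N) : modKernel β t (n + 1) k < modKernel β t n k := by
  have hκ := kernelConst_pos hβ0
  have hab := ht.2 k hk (by omega)
  have hde : t n < t (n + 1) := ht.lt (by omega) (by omega)
  rcases hkn.eq_or_lt with rfl | h
  · rw [modKernel_self hβ0 ht (by omega), modKernel_of_lt hβ0 ht (by omega) hn,
      div_lt_div_iff_of_pos_right hκ, Nat.add_sub_cancel, step, step, Nat.add_sub_cancel]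
    exact cellInt_adjacent_lt hβ0 hβ1 hab hde
  · rw [modKernel_of_lt hβ0 ht h (by omega), modKernel_of_lt hβ0 ht (by omega) hn,
      div_lt_div_iff_of_pos_right hκ, Nat.add_sub_cancel, ← div_div, ← div_div,
      div_lt_div_iff_of_pos_right (ht.step_pos hk (by omega)), step, step,
      Nat.add_sub_cancel]
    have hcd := ht.2 n (by omega) (by omega)
    have hbc : t k ≤ t (n - 1) := ht.le (by omega) (by omega)
    have := cellInt_div_lt hβ0 hβ1 (neg_lt_neg hde) (neg_lt_neg hcd) (neg_le_neg hbc)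
      (neg_lt_neg hab)
    rwa [cellInt_neg, cellInt_neg, neg_sub_neg, neg_sub_neg] at this

theorem modKernel_lt_left (hβ0 : 0 < β) (hβ1 : β < 1) (ht : IsMesh N t) :
    ∀ n k j, 1 ≤ k → k ≤ j → j < n → n ≤ N → modKernel β t n k < modKernel β t j k := by
  intro n k j hk hkj hjn
  induction n, hjn using Nat.le_induction with
  | base => exact fun hn => modKernel_succ_left_lt hβ0 hβ1 ht hk hkj hn
  | succ n hjn ih =>
    exact fun hn => (modKernel_succ_left_lt hβ0 hβ1 ht hk (by omega) hn).trans (ih (by omega))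

/-- Both products carry the same step sizes, so only the cell inequality matters and no restriction
on the mesh is needed. -/
theorem modKernel_mul_le_of_lt (hβ0 : 0 < β) (hβ1 : β < 1) (ht : IsMesh N t) {n k j : ℕ}
    (hk : 1 ≤ k) (hkj : k < j) (hjn : j < n) (hn : n + 1 ≤ N) :
    modKernel β t n k * modKernel β t (n + 1) j ≤ modKernel β t (n + 1) k * modKernel β t n j := by
  have hκ := kernelConst_pos hβ0
  rw [modKernel_of_lt hβ0 ht (by omega : k < n) (by omega),
    modKernel_of_lt hβ0 ht (by omega : j < n + 1) (by omega),
    modKernel_of_lt hβ0 ht (by omega : k < n + 1) (by omega),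
    modKernel_of_lt hβ0 ht (by omega : j < n) (by omega), Nat.add_sub_cancel]
  have h := cellInt_mul_le hβ0 hβ1 (ht.2 k hk (by omega))
    (ht.le (by omega : k ≤ j - 1) (by omega)) (ht.2 j (by omega) (by omega))
    (ht.le (by omega : j ≤ n - 1) (by omega)) (ht.2 n (by omega) (by omega)) le_rfl
    (ht.lt (by omega : n < n + 1) hn)
  have h1 := ht.step_pos hk (by omega)
  have h2 := ht.step_pos (by omega : 1 ≤ j) (by omega)
  have h3 := ht.step_pos (by omega : 1 ≤ n) (by omega)
  have h4 := ht.step_pos (by omega : 1 ≤ n + 1) hn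
  set κ := β * (1 + β) * Real.Gamma β
  have h5 := div_le_div_of_nonneg_right h
    (by positivity : 0 ≤ κ * κ * (step t k * step t j * step t n * step t (n + 1)))
  refine le_trans (le_of_eq ?_) (h5.trans (le_of_eq ?_)) <;> field_simp

/-- The diagonal cell is a triangle, where sources are not separated from targets and the
log-convexity argument fails. In the ratios `r = q/p`, `y = s/q` the claim is `rho_mul_rho_le`,
whose factor 2 is the doubled diagonal. -/
theorem modKernel_mul_le_adjacent (hβ0 : 0 < β) (hβ1 : β < 1) (ht : IsMesh N t)
    (hr : StepRatioConstraint β N t) {n : ℕ} (hk : 1 ≤ n) (hn : n + 2 ≤ N) :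
    modKernel β t (n + 1) n * modKernel β t (n + 2) (n + 1)
      ≤ modKernel β t (n + 2) n * modKernel β t (n + 1) (n + 1) := by
  have hκ := kernelConst_pos hβ0
  have h1 := ht.step_pos hk (by omega)
  have h2 := ht.step_pos (by omega : 1 ≤ n + 1) (by omega)
  have h3 := ht.step_pos (by omega : 1 ≤ n + 2) (by omega)
  have hrn := hr (n + 1) (by omega) hn
  rw [ratio, ratio, Nat.add_sub_cancel, Nat.add_sub_cancel (n + 1) 1] at hrn
  have key := rho_mul_rho_le hβ0 hβ1 (div_pos h2 h1) (div_pos h3 h2) hrn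
  rw [modKernel_of_lt hβ0 ht (by omega : n < n + 1) (by omega),
    modKernel_of_lt hβ0 ht (by omega : n + 1 < n + 2) (by omega),
    modKernel_of_lt hβ0 ht (by omega : n < n + 2) (by omega),
    modKernel_self hβ0 ht (by omega), Nat.add_sub_cancel, show n + 2 - 1 = n + 1 from rfl]
  have hp : t n - t (n - 1) = step t n := rfl
  have hq : t (n + 1) - t n = step t (n + 1) := rfl
  have hs : t (n + 2) - t (n + 1) = step t (n + 2) := rfl
  set p := step t n
  set q := step t (n + 1)
  set s := step t (n + 2)
  have e1 : cellInt β (t (n - 1)) (t n) (t n) (t (n + 1)) = p ^ (1 + β) * rho β (q / p) := by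
    rw [cellInt_adjacent _ _ _ hβ0, rpow_mul_rho_div h1 h2.le, hp, hq,
      show t (n + 1) - t (n - 1) = p + q by linarith]
  have e2 : cellInt β (t n) (t (n + 1)) (t (n + 1)) (t (n + 2)) = q ^ (1 + β) * rho β (s / q) := by
    rw [cellInt_adjacent _ _ _ hβ0, rpow_mul_rho_div h2 h3.le, hq, hs,
      show t (n + 2) - t n = q + s by linarith]
  have e3 : cellInt β (t (n - 1)) (t n) (t (n + 1)) (t (n + 2))
      = p ^ (1 + β) * (rho β (q / p + q / p * (s / q)) - rho β (q / p)) := by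
    rw [show q / p + q / p * (s / q) = (q + s) / p by field_simp, mul_sub,
      rpow_mul_rho_div h1 h2.le, rpow_mul_rho_div h1 (by positivity), cellInt, hq,
      show t (n + 2) - t (n - 1) = p + (q + s) by linarith,
      show t (n + 1) - t (n - 1) = p + q by linarith,
      show t (n + 2) - t n = q + s by linarith]
    ring
  rw [e1, e2, e3]
  have hpq : 0 < p ^ (1 + β) * q ^ (1 + β) :=
    mul_pos (Real.rpow_pos_of_pos h1 _) (Real.rpow_pos_of_pos h2 _)
  set κ := β * (1 + β) * Real.Gamma β
  have h5 := mul_le_mul_of_nonneg_left key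
    (by positivity : 0 ≤ p ^ (1 + β) * q ^ (1 + β) / (κ * κ * (p * q * q * s)))
  refine le_trans (le_of_eq ?_) (h5.trans (le_of_eq ?_)) <;> field_simp

theorem modKernel_mul_le (hβ0 : 0 < β) (hβ1 : β < 1) (ht : IsMesh N t)
    (hr : StepRatioConstraint β N t) :
    ∀ n k j, 1 ≤ k → k < j → j ≤ n → n + 1 ≤ N →
      modKernel β t n k * modKernel β t (n + 1) j
        ≤ modKernel β t (n + 1) k * modKernel β t n j := by
  intro n k j hk hkj hjn hn
  rcases hjn.eq_or_lt with rfl | hjn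
  · obtain ⟨m, rfl⟩ : ∃ m, j = m + 1 := ⟨j - 1, by omega⟩
    have hadj := modKernel_mul_le_adjacent hβ0 hβ1 ht hr (by omega : 1 ≤ m) (by omega)
    rcases (by omega : k = m ∨ k < m) with rfl | hkm
    · exact hadj
    · have h1 := modKernel_mul_le_of_lt hβ0 hβ1 ht hk hkm (by omega : m < m + 1) hn
      have p1 := modKernel_pos hβ0 ht (m + 1) m (by omega) (by omega) (by omega)
      have p2 := modKernel_pos hβ0 ht (m + 1 + 1) m (by omega) (by omega) (by omega)
      have p3 := modKernel_pos hβ0 ht (m + 1 + 1) (m + 1) (by omega) (by omega) (by omega)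
      have p4 := modKernel_pos hβ0 ht (m + 1 + 1) k (by omega) (by omega) (by omega)
      -- The quotient of rows at column `k` is compared with that at `m`, and then with that at the
      -- diagonal column `m + 1`.
      refine le_of_mul_le_mul_right ?_ (mul_pos p1 p2)
      calc _ = modKernel β t (m + 1) k * modKernel β t (m + 1 + 1) m
            * (modKernel β t (m + 1) m * modKernel β t (m + 1 + 1) (m + 1)) := by ring
        _ ≤ modKernel β t (m + 1 + 1) k * modKernel β t (m + 1) m
            * (modKernel β t (m + 1 + 1) m * modKernel β t (m + 1) (m + 1)) :=
          mul_le_mul h1 hadj (by positivity) (by positivity)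
        _ = _ := by ring
  · exact modKernel_mul_le_of_lt hβ0 hβ1 ht hk hkj hjn hn

end Mesh

/-! ### Green's formula for smooth periodic functions. -/

section Periodic

variable {L₁ L₂ : ℝ}

instance : IsFiniteMeasure (cell L₁ L₂) := by
  refine ⟨?_⟩
  rw [cell, Measure.restrict_apply_univ, Measure.volume_eq_prod, Measure.prod_prod]
  exact ENNReal.mul_lt_top (by simp) (by simp)

theorem cell_eq : cell L₁ L₂ = volume.restrict (Set.Icc ((0 : ℝ), (0 : ℝ)) (L₁, L₂)) := by
  rw [cell, ← Set.Icc_prod_Icc]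
  exact Measure.restrict_congr_set
    (Measure.set_prod_ae_eq Ioo_ae_eq_Icc Ioo_ae_eq_Icc)

theorem SmoothPeriodic.differentiable {φ : ℝ × ℝ → ℝ} (h : SmoothPeriodic L₁ L₂ φ) :
    Differentiable ℝ φ := h.1.differentiable (by simp)

theorem SmoothPeriodic.continuous {φ : ℝ × ℝ → ℝ} (h : SmoothPeriodic L₁ L₂ φ) :
    Continuous φ := h.1.continuous

theorem SmoothPeriodic.fderiv_apply {φ : ℝ × ℝ → ℝ} (h : SmoothPeriodic L₁ L₂ φ) (e : ℝ × ℝ) :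
    SmoothPeriodic L₁ L₂ (fun z => fderiv ℝ φ z e) := by
  refine ⟨(h.1.fderiv_right (by simp)).clm_apply contDiff_const, fun x y => ⟨?_, ?_⟩⟩
  · have h1 : (fun z => φ (z + (L₁, 0))) = φ := by
      funext ⟨a, b⟩
      simpa using (h.2 a b).1
    have := fderiv_comp_add_right (𝕜 := ℝ) (f := φ) (x := (x, y)) (L₁, (0 : ℝ))
    rw [h1] at this
    simp only [Prod.mk_add_mk, add_zero] at this
    exact congrArg (fun T : ℝ × ℝ →L[ℝ] ℝ => T e) this.symm
  · have h1 : (fun z => φ (z + (0, L₂))) = φ := by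
      funext ⟨a, b⟩
      simpa using (h.2 a b).2
    have := fderiv_comp_add_right (𝕜 := ℝ) (f := φ) (x := (x, y)) ((0 : ℝ), L₂)
    rw [h1] at this
    simp only [Prod.mk_add_mk, add_zero] at this
    exact congrArg (fun T : ℝ × ℝ →L[ℝ] ℝ => T e) this.symm

theorem SmoothPeriodic.dx {φ : ℝ × ℝ → ℝ} (h : SmoothPeriodic L₁ L₂ φ) :
    SmoothPeriodic L₁ L₂ (dx φ) := h.fderiv_apply _

theorem SmoothPeriodic.dy {φ : ℝ × ℝ → ℝ} (h : SmoothPeriodic L₁ L₂ φ) :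
    SmoothPeriodic L₁ L₂ (dy φ) := h.fderiv_apply _

theorem SmoothPeriodic.sub {φ ψ : ℝ × ℝ → ℝ} (hφ : SmoothPeriodic L₁ L₂ φ)
    (hψ : SmoothPeriodic L₁ L₂ ψ) : SmoothPeriodic L₁ L₂ (fun z => φ z - ψ z) :=
  ⟨hφ.1.sub hψ.1, fun x y => by simp only [hφ.2, hψ.2, and_self]⟩

theorem SmoothPeriodic.add {φ ψ : ℝ × ℝ → ℝ} (hφ : SmoothPeriodic L₁ L₂ φ)
    (hψ : SmoothPeriodic L₁ L₂ ψ) : SmoothPeriodic L₁ L₂ (fun z => φ z + ψ z) :=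
  ⟨hφ.1.add hψ.1, fun x y => by simp only [hφ.2, hψ.2, and_self]⟩

theorem SmoothPeriodic.mul {φ ψ : ℝ × ℝ → ℝ} (hφ : SmoothPeriodic L₁ L₂ φ)
    (hψ : SmoothPeriodic L₁ L₂ ψ) : SmoothPeriodic L₁ L₂ (fun z => φ z * ψ z) :=
  ⟨hφ.1.mul hψ.1, fun x y => by simp only [hφ.2, hψ.2, and_self]⟩

theorem SmoothPeriodic.lap {φ : ℝ × ℝ → ℝ} (h : SmoothPeriodic L₁ L₂ φ) :
    SmoothPeriodic L₁ L₂ (lap φ) := h.dx.dx.add h.dy.dy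

theorem SmoothPeriodic.memLp {φ : ℝ × ℝ → ℝ} (h : SmoothPeriodic L₁ L₂ φ) (p : ENNReal) :
    MemLp φ p (cell L₁ L₂) := by
  obtain ⟨C, hC⟩ := (isCompact_Icc (a := ((0 : ℝ), (0 : ℝ))) (b := (L₁, L₂))).exists_bound_of_continuousOn
    h.continuous.continuousOn
  refine MemLp.of_bound h.continuous.aestronglyMeasurable C ?_
  rw [cell_eq]
  exact (ae_restrict_iff' measurableSet_Icc).mpr (Eventually.of_forall hC)

/-- The divergence theorem on the closed rectangle; opposite sides cancel by periodicity. -/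
theorem integral_divergence_eq_zero (hL₁ : 0 < L₁) (hL₂ : 0 < L₂) {F G : ℝ × ℝ → ℝ}
    (hF : SmoothPeriodic L₁ L₂ F) (hG : SmoothPeriodic L₁ L₂ G) :
    ∫ z, (dx F z + dy G z) ∂(cell L₁ L₂) = 0 := by
  have hint : Integrable (fun z => dx F z + dy G z) (cell L₁ L₂) :=
    memLp_one_iff_integrable.mp ((hF.dx.add hG.dy).memLp 1)
  rw [cell_eq] at hint ⊢
  have h := integral_divergence_prod_Icc_of_hasFDerivAt_off_countable_of_le F G (fderiv ℝ F)
    (fderiv ℝ G) ((0 : ℝ), (0 : ℝ)) (L₁, L₂) (Prod.mk_le_mk.mpr ⟨hL₁.le, hL₂.le⟩) ∅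
    Set.countable_empty hF.continuous.continuousOn hG.continuous.continuousOn
    (fun x _ => (hF.differentiable x).hasFDerivAt) (fun x _ => (hG.differentiable x).hasFDerivAt)
    hint
  refine h.trans ?_
  have e1 : ∀ y, F (L₁, y) = F (0, y) := fun y => by simpa using (hF.2 0 y).1
  have e2 : ∀ x, G (x, L₂) = G (x, 0) := fun x => by simpa using (hG.2 x 0).2
  simp [e1, e2]

theorem integral_mul_lap (hL₁ : 0 < L₁) (hL₂ : 0 < L₂) {ψ φ : ℝ × ℝ → ℝ}
    (hψ : SmoothPeriodic L₁ L₂ ψ) (hφ : SmoothPeriodic L₁ L₂ φ) :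
    ∫ z, ψ z * lap φ z ∂(cell L₁ L₂)
      = -(∫ z, dx ψ z * dx φ z ∂(cell L₁ L₂) + ∫ z, dy ψ z * dy φ z ∂(cell L₁ L₂)) := by
  have h := integral_divergence_eq_zero hL₁ hL₂ (hψ.mul hφ.dx) (hψ.mul hφ.dy)
  have e : ∀ z, dx (fun z => ψ z * dx φ z) z + dy (fun z => ψ z * dy φ z) z
      = ψ z * lap φ z + (dx ψ z * dx φ z + dy ψ z * dy φ z) := by
    intro z
    have h1 : dx (fun z => ψ z * dx φ z) z = ψ z * dx (dx φ) z + dx φ z * dx ψ z := by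
      rw [dx, fderiv_fun_mul (hψ.differentiable z) (hφ.dx.differentiable z)]
      rfl
    have h2 : dy (fun z => ψ z * dy φ z) z = ψ z * dy (dy φ) z + dy φ z * dy ψ z := by
      rw [dy, fderiv_fun_mul (hψ.differentiable z) (hφ.dy.differentiable z)]
      rfl
    rw [h1, h2, lap]
    ring
  have hi : ∀ {F : ℝ × ℝ → ℝ}, SmoothPeriodic L₁ L₂ F → Integrable F (cell L₁ L₂) :=
    fun hF => memLp_one_iff_integrable.mp (hF.memLp 1)
  simp_rw [e] at h
  rw [integral_add (hi (hψ.mul hφ.lap)) (hi ((hψ.dx.mul hφ.dx).add (hψ.dy.mul hφ.dy))),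
    integral_add (hi (hψ.dx.mul hφ.dx)) (hi (hψ.dy.mul hφ.dy))] at h
  linarith

end Periodic

/-! ### Passing to the limit in integrals of products. -/

section Limits

variable {μ : Measure (ℝ × ℝ)}

instance : ENNReal.HolderTriple 4 4 2 := ⟨by
  rw [← two_mul, show (4 : ENNReal) = 2 * 2 by norm_num,
    ENNReal.mul_inv (by simp) (by simp), ← mul_assoc, ENNReal.mul_inv_cancel (by simp) (by simp),
    one_mul]⟩

theorem tendsto_eLpNorm_mul {p q r : ENNReal} [p.HolderTriple q r] {f : ℕ → ℝ × ℝ → ℝ}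
    {g h : ℝ × ℝ → ℝ} (hf : ∀ m, AEStronglyMeasurable (f m) μ) (hg : AEStronglyMeasurable g μ)
    (hh : MemLp h q μ)
    (hlim : Tendsto (fun m => eLpNorm (fun z => f m z - g z) p μ) atTop (𝓝 0)) :
    Tendsto (fun m => eLpNorm (fun z => f m z * h z - g z * h z) r μ) atTop (𝓝 0) := by
  have h0 : Tendsto (fun m => eLpNorm (fun z => f m z - g z) p μ * eLpNorm h q μ) atTop (𝓝 0) := by
    simpa using ENNReal.Tendsto.mul_const hlim (Or.inr hh.eLpNorm_ne_top)
  refine tendsto_of_tendsto_of_tendsto_of_le_of_le tendsto_const_nhds h0 (fun _ => zero_le)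
    fun m => ?_
  have := eLpNorm_smul_le_mul_eLpNorm (p := p) (q := q) (r := r) hh.1 ((hf m).sub hg)
  refine le_trans (le_of_eq ?_) this
  congr 1
  funext z
  simp [sub_mul]

theorem tendsto_integral_mul {p q : ENNReal} [p.HolderTriple q 1] {f : ℕ → ℝ × ℝ → ℝ}
    {g h : ℝ × ℝ → ℝ} (hf : ∀ m, MemLp (f m) p μ) (hg : MemLp g p μ) (hh : MemLp h q μ)
    (hlim : Tendsto (fun m => eLpNorm (fun z => f m z - g z) p μ) atTop (𝓝 0)) :
    Tendsto (fun m => ∫ z, f m z * h z ∂μ) atTop (𝓝 (∫ z, g z * h z ∂μ)) :=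
  tendsto_integral_of_L1' _ (hg.1.mul hh.1)
    (Eventually.of_forall fun m => memLp_one_iff_integrable.mp (hh.mul (hf m)))
    (tendsto_eLpNorm_mul (fun m => (hf m).1) hg.1 hh hlim)

/-- The exponents `4, 4, 2` fit the cubic term: approximated test function, midpoint value, and a
quadratic factor in `L²`. -/
theorem tendsto_integral_mul_mul {f : ℕ → ℝ × ℝ → ℝ} {g h k : ℝ × ℝ → ℝ}
    (hf : ∀ m, MemLp (f m) 4 μ) (hg : MemLp g 4 μ) (hh : MemLp h 4 μ) (hk : MemLp k 2 μ)
    (hlim : Tendsto (fun m => eLpNorm (fun z => f m z - g z) 4 μ) atTop (𝓝 0)) :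
    Tendsto (fun m => ∫ z, f m z * h z * k z ∂μ) atTop (𝓝 (∫ z, g z * h z * k z ∂μ)) :=
  tendsto_integral_mul (p := 2) (q := 2) (f := fun m z => f m z * h z) (g := fun z => g z * h z)
    (fun m => hh.mul (hf m)) (hh.mul hg) hk
    (tendsto_eLpNorm_mul (p := 4) (q := 4) (fun m => (hf m).1) hg.1 hh hlim)

end Limits

/-! ### The energy increment obtained by testing the chemical potential. -/

section Energy

variable {L₁ L₂ : ℝ}

theorem tendsto_eLpNorm_sub_sub {μ : Measure (ℝ × ℝ)} {p : ENNReal} (hp : 1 ≤ p)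
    {f f' : ℕ → ℝ × ℝ → ℝ} {g g' : ℝ × ℝ → ℝ}
    (hf : ∀ m, AEStronglyMeasurable (f m) μ) (hg : AEStronglyMeasurable g μ)
    (hf' : ∀ m, AEStronglyMeasurable (f' m) μ) (hg' : AEStronglyMeasurable g' μ)
    (h : Tendsto (fun m => eLpNorm (fun z => f m z - g z) p μ) atTop (𝓝 0))
    (h' : Tendsto (fun m => eLpNorm (fun z => f' m z - g' z) p μ) atTop (𝓝 0)) :
    Tendsto (fun m => eLpNorm (fun z => (f m z - f' m z) - (g z - g' z)) p μ) atTop (𝓝 0) := by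
  have h0 := h.add h'
  rw [add_zero] at h0
  refine tendsto_of_tendsto_of_tendsto_of_le_of_le tendsto_const_nhds h0 (fun _ => zero_le)
    fun m => ?_
  refine le_trans (le_of_eq ?_) (eLpNorm_sub_le ((hf m).sub hg) ((hf' m).sub hg') hp)
  congr 1
  funext z
  simp only [Pi.sub_apply]
  ring

theorem HasPeriodicGradient.sub {u g₁ g₂ v h₁ h₂ : ℝ × ℝ → ℝ}
    (hu : HasPeriodicGradient L₁ L₂ u g₁ g₂) (hv : HasPeriodicGradient L₁ L₂ v h₁ h₂) :
    HasPeriodicGradient L₁ L₂ (fun z => u z - v z) (fun z => g₁ z - h₁ z)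
      (fun z => g₂ z - h₂ z) := by
  obtain ⟨mu, mg₁, mg₂, φ, hφ, l0, l1, l2⟩ := hu
  obtain ⟨mv, mh₁, mh₂, ψ, hψ, k0, k1, k2⟩ := hv
  have ex : ∀ m, dx (fun z => φ m z - ψ m z) = fun z => dx (φ m) z - dx (ψ m) z := by
    intro m
    funext z
    rw [dx, fderiv_fun_sub ((hφ m).differentiable z) ((hψ m).differentiable z)]
    rfl
  have ey : ∀ m, dy (fun z => φ m z - ψ m z) = fun z => dy (φ m) z - dy (ψ m) z := by
    intro m
    funext z
    rw [dy, fderiv_fun_sub ((hφ m).differentiable z) ((hψ m).differentiable z)]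
    rfl
  refine ⟨mu.sub mv, mg₁.sub mh₁, mg₂.sub mh₂, fun m z => φ m z - ψ m z,
    fun m => (hφ m).sub (hψ m), ?_, ?_, ?_⟩
  · exact tendsto_eLpNorm_sub_sub (by norm_num) (fun m => ((hφ m).memLp 4).1) mu.1
      (fun m => ((hψ m).memLp 4).1) mv.1 l0 k0
  · simp only [ex]
    exact tendsto_eLpNorm_sub_sub (by norm_num) (fun m => ((hφ m).dx.memLp 4).1) mg₁.1
      (fun m => ((hψ m).dx.memLp 4).1) mh₁.1 l1 k1
  · simp only [ey]
    exact tendsto_eLpNorm_sub_sub (by norm_num) (fun m => ((hφ m).dy.memLp 4).1) mg₂.1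
      (fun m => ((hψ m).dy.memLp 4).1) mh₂.1 l2 k2

theorem memLp_two_of_four {u : ℝ × ℝ → ℝ} (h : MemLp u 4 (cell L₁ L₂)) :
    MemLp u 2 (cell L₁ L₂) := h.mono_exponent (by norm_num)

/-- Integration by parts against a smooth test function. -/
theorem HasPeriodicGradient.integral_mul_lap (hL₁ : 0 < L₁) (hL₂ : 0 < L₂)
    {u g₁ g₂ φ : ℝ × ℝ → ℝ} (hu : HasPeriodicGradient L₁ L₂ u g₁ g₂)
    (hφ : SmoothPeriodic L₁ L₂ φ) :
    ∫ z, u z * lap φ z ∂(cell L₁ L₂)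
      = -(∫ z, g₁ z * dx φ z ∂(cell L₁ L₂) + ∫ z, g₂ z * dy φ z ∂(cell L₁ L₂)) := by
  obtain ⟨mu, mg₁, mg₂, ψ, hψ, l0, l1, l2⟩ := hu
  have t0 := tendsto_integral_mul_mul (fun m => (hψ m).memLp 4) mu (memLp_const (1 : ℝ))
    (hφ.lap.memLp 2) l0
  have t1 := tendsto_integral_mul (p := 2) (q := 2) (fun m => (hψ m).dx.memLp 2) mg₁
    (hφ.dx.memLp 2) l1
  have t2 := tendsto_integral_mul (p := 2) (q := 2) (fun m => (hψ m).dy.memLp 2) mg₂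
    (hφ.dy.memLp 2) l2
  simp only [mul_one] at t0
  refine tendsto_nhds_unique t0 ?_
  simp_rw [TFKG.integral_mul_lap hL₁ hL₂ (hψ _) hφ]
  exact (t1.add t2).neg

theorem integrable_mul_of_memLp_two {μ : Measure (ℝ × ℝ)} {f g : ℝ × ℝ → ℝ} (hf : MemLp f 2 μ)
    (hg : MemLp g 2 μ) : Integrable (fun z => f z * g z) μ :=
  memLp_one_iff_integrable.mp (hg.mul hf)

theorem memLp_mul_of_memLp_four {μ : Measure (ℝ × ℝ)} {f g : ℝ × ℝ → ℝ} (hf : MemLp f 4 μ)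
    (hg : MemLp g 4 μ) : MemLp (fun z => f z * g z) 2 μ := hg.mul hf

theorem HasPeriodicGradient.integrable_energy {ε : ℝ} {a g₁ g₂ : ℝ × ℝ → ℝ}
    (ha : HasPeriodicGradient L₁ L₂ a g₁ g₂) :
    Integrable (fun z => ε ^ 2 / 2 * (g₁ z ^ 2 + g₂ z ^ 2) + 1 / 4 * (a z ^ 2 - 1) ^ 2)
      (cell L₁ L₂) := by
  obtain ⟨ma, mg₁, mg₂, -⟩ := ha
  have hF : MemLp (fun z => a z * a z - 1) 2 (cell L₁ L₂) :=
    (memLp_mul_of_memLp_four ma ma).sub (memLp_const (1 : ℝ))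
  have := (((integrable_mul_of_memLp_two mg₁ mg₁).add
    (integrable_mul_of_memLp_two mg₂ mg₂)).const_mul (ε ^ 2 / 2)).add
    ((integrable_mul_of_memLp_two hF hF).const_mul (1 / 4))
  simp only [pow_two] at this ⊢
  exact this

/-- Testing the chemical potential with the increment gives the increment of the energy. -/
theorem IsPotential.integral_sub_mul (hL₁ : 0 < L₁) (hL₂ : 0 < L₂) {ε : ℝ}
    {a g₁ g₂ b h₁ h₂ ζ : ℝ × ℝ → ℝ} (ha : HasPeriodicGradient L₁ L₂ a g₁ g₂)
    (hb : HasPeriodicGradient L₁ L₂ b h₁ h₂) (hζ : IsPotential L₁ L₂ ε a b ζ) :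
    ∫ z, (a z - b z) * ζ z ∂(cell L₁ L₂) = energy L₁ L₂ ε a g₁ g₂ - energy L₁ L₂ ε b h₁ h₂ := by
  obtain ⟨mζ, hw⟩ := hζ
  have ma := ha.1
  have mb := hb.1
  have mg₁ := ha.2.1
  have mg₂ := ha.2.2.1
  have mh₁ := hb.2.1
  have mh₂ := hb.2.2.1
  have mmid : MemLp (fun z => mid (a z) (b z)) 4 (cell L₁ L₂) := by
    have := (ma.add mb).const_mul (1 / 2 : ℝ)
    have e : (fun z => mid (a z) (b z)) = fun z => 1 / 2 * (a + b) z := by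
      funext z
      simp only [mid, Pi.add_apply]
      ring
    rwa [e]
  have mk : MemLp (fun z => 1 / 2 * (a z * a z + b z * b z) - 1) 2 (cell L₁ L₂) :=
    (((memLp_mul_of_memLp_four ma ma).add (memLp_mul_of_memLp_four mb mb)).const_mul
      (1 / 2 : ℝ)).sub (memLp_const (1 : ℝ))
  have mm₁ : MemLp (fun z => 1 / 2 * (g₁ z + h₁ z)) 2 (cell L₁ L₂) :=
    (mg₁.add mh₁).const_mul (1 / 2 : ℝ)
  have mm₂ : MemLp (fun z => 1 / 2 * (g₂ z + h₂ z)) 2 (cell L₁ L₂) :=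
    (mg₂.add mh₂).const_mul (1 / 2 : ℝ)
  -- Moving the Laplacian off `φ` leaves only terms continuous under `L⁴` convergence of `φ` and
  -- `L²` convergence of its gradient, so `φ` may approximate `a - b`. The factor `1` puts the `ζ`
  -- term in the form of `tendsto_integral_mul_mul`.
  have weak : ∀ φ, SmoothPeriodic L₁ L₂ φ →
      ∫ z, φ z * 1 * ζ z ∂(cell L₁ L₂)
        = ∫ z, φ z * mid (a z) (b z) * (1 / 2 * (a z * a z + b z * b z) - 1) ∂(cell L₁ L₂)
        + ε ^ 2 * (∫ z, dx φ z * (1 / 2 * (g₁ z + h₁ z)) ∂(cell L₁ L₂)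
          + ∫ z, dy φ z * (1 / 2 * (g₂ z + h₂ z)) ∂(cell L₁ L₂)) := by
    intro φ hφ
    have half : ∀ {f g k : ℝ × ℝ → ℝ}, MemLp f 2 (cell L₁ L₂) → MemLp g 2 (cell L₁ L₂) →
        MemLp k 2 (cell L₁ L₂) → ∫ z, k z * (1 / 2 * (f z + g z)) ∂(cell L₁ L₂)
          = 1 / 2 * (∫ z, f z * k z ∂(cell L₁ L₂) + ∫ z, g z * k z ∂(cell L₁ L₂)) := by
      intro f g k hf hg hk
      rw [← integral_add (integrable_mul_of_memLp_two hf hk) (integrable_mul_of_memLp_two hg hk),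
        ← integral_const_mul]
      congr 1
      funext z
      ring
    have e1 : ∫ z, mid (a z) (b z) * lap φ z ∂(cell L₁ L₂)
        = 1 / 2 * (∫ z, a z * lap φ z ∂(cell L₁ L₂) + ∫ z, b z * lap φ z ∂(cell L₁ L₂)) := by
      rw [← half (memLp_two_of_four ma) (memLp_two_of_four mb) (hφ.lap.memLp 2)]
      congr 1
      funext z
      rw [mid]
      ring
    have e2 : ∫ z, fHalf (a z) (b z) * φ z ∂(cell L₁ L₂)
        = ∫ z, φ z * mid (a z) (b z) * (1 / 2 * (a z * a z + b z * b z) - 1) ∂(cell L₁ L₂) := by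
      congr 1
      funext z
      rw [fHalf]
      ring
    have e3 : ∫ z, φ z * 1 * ζ z ∂(cell L₁ L₂) = ∫ z, ζ z * φ z ∂(cell L₁ L₂) := by
      congr 1
      funext z
      ring
    rw [e3, hw φ hφ, e1, e2, ha.integral_mul_lap hL₁ hL₂ hφ, hb.integral_mul_lap hL₁ hL₂ hφ,
      half mg₁ mh₁ (hφ.dx.memLp 2), half mg₂ mh₂ (hφ.dy.memLp 2)]
    ring
  obtain ⟨mab, mgh₁, mgh₂, φ, hφ, l0, l1, l2⟩ := ha.sub hb
  have t0 := tendsto_integral_mul_mul (fun m => (hφ m).memLp 4) mab (memLp_const (1 : ℝ)) mζ l0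
  have t1 := tendsto_integral_mul_mul (fun m => (hφ m).memLp 4) mab mmid mk l0
  have t2 := tendsto_integral_mul (p := 2) (q := 2) (fun m => (hφ m).dx.memLp 2) mgh₁ mm₁ l1
  have t3 := tendsto_integral_mul (p := 2) (q := 2) (fun m => (hφ m).dy.memLp 2) mgh₂ mm₂ l2
  simp_rw [weak _ (hφ _)] at t0
  have h := tendsto_nhds_unique t0 (t1.add ((t2.add t3).const_mul (ε ^ 2)))
  simp only [mul_one] at h
  have i1 := integrable_mul_of_memLp_two (memLp_mul_of_memLp_four mab mmid) mk
  have i2 := integrable_mul_of_memLp_two mgh₁ mm₁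
  have i3 := integrable_mul_of_memLp_two mgh₂ mm₂
  have i4 : Integrable (fun z => ε ^ 2 * ((g₁ z - h₁ z) * (1 / 2 * (g₁ z + h₁ z))
      + (g₂ z - h₂ z) * (1 / 2 * (g₂ z + h₂ z)))) (cell L₁ L₂) := (i2.add i3).const_mul _
  rw [h, energy, energy, ← integral_sub ha.integrable_energy hb.integrable_energy,
    ← integral_add i2 i3, ← integral_const_mul, ← integral_add i1 i4]
  congr 1
  funext z
  -- Pointwise, `(a-b) (a+b)/2 ((a²+b²)/2 - 1) = ((a²-1)² - (b²-1)²)/4`, and likewise the gradient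
  -- products are differences of squares.
  simp only [mid]
  ring

end Energy

/-! ### The averaged fractional integral as a discrete convolution. -/

section AvgIntegral

variable {β : ℝ} {N : ℕ} {t : ℕ → ℝ}

theorem intervalIntegrable_omega (hβ0 : 0 < β) (x a b : ℝ) :
    IntervalIntegrable (fun s => omega β (x - s)) volume a b :=
  (intervalIntegrable_rpow_const_sub hβ0 x a b).div_const _

theorem integral_omega_mul_indicator (ht : IsMesh N t) {n k : ℕ} (w x : ℝ)
    (hk : 1 ≤ k) (hkN : k ≤ N) (hn : 1 ≤ n) (hnN : n ≤ N) (hx : x ∈ Set.Icc (t (n - 1)) (t n)) :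
    ∫ s in (0 : ℝ)..x, omega β (x - s) * (Set.Ioc (t (k - 1)) (t k)).indicator (fun _ => w) s
      = if k ≤ n then (∫ s in t (k - 1)..min x (t k), omega β (x - s)) * w else 0 := by
  have h0 : ∀ i, i ≤ N → 0 ≤ t i := fun i hi => by
    rw [← ht.1]; exact ht.le (Nat.zero_le _) hi
  have hx0 : 0 ≤ x := (h0 (n - 1) (by omega)).trans hx.1
  have e : ∀ s, omega β (x - s) * (Set.Ioc (t (k - 1)) (t k)).indicator (fun _ => w) s
      = (Set.Ioc (t (k - 1)) (t k)).indicator (fun s => omega β (x - s) * w) s := by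
    intro s
    by_cases hs : s ∈ Set.Ioc (t (k - 1)) (t k) <;> simp [hs]
  simp_rw [e]
  rw [intervalIntegral.integral_of_le hx0, setIntegral_indicator measurableSet_Ioc,
    Set.Ioc_inter_Ioc, max_eq_right (h0 (k - 1) (by omega))]
  split_ifs with hkn
  · rw [← intervalIntegral.integral_mul_const, intervalIntegral.integral_of_le]
    exact le_min ((ht.le (by omega) (by omega)).trans hx.1) (ht.2 k hk hkN).le
  · rw [Set.Ioc_eq_empty, setIntegral_empty]
    rw [not_lt]
    exact (min_le_left _ _).trans (hx.2.trans (ht.le (by omega) (by omega)))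

theorem avgIntegral_eq (hβ0 : 0 < β) (ht : IsMesh N t) (w : ℕ → ℝ) {n : ℕ} (hn : 1 ≤ n)
    (hnN : n ≤ N) :
    avgIntegral β N t w n = ∑ k ∈ Finset.Icc 1 n, kernel β t n k * step t k * w k := by
  have hin : ∀ x ∈ Set.uIcc (t (n - 1)) (t n),
      ∫ s in (0 : ℝ)..x, omega β (x - s) * interp N t w s
        = ∑ k ∈ Finset.Icc 1 n, (∫ s in t (k - 1)..min x (t k), omega β (x - s)) * w k := by
    intro x hx
    rw [Set.uIcc_of_le (ht.le (by omega) hnN)] at hx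
    simp_rw [interp, Finset.mul_sum]
    rw [intervalIntegral.integral_finsetSum]
    · rw [Finset.sum_congr rfl fun k hk => integral_omega_mul_indicator ht (w k) x
        (Finset.mem_Icc.mp hk).1 (Finset.mem_Icc.mp hk).2 hn hnN hx, ← Finset.sum_filter]
      congr 1
      ext k
      simp only [Finset.mem_filter, Finset.mem_Icc]
      omega
    · intro k _
      have e : (fun s => omega β (x - s) * (Set.Ioc (t (k - 1)) (t k)).indicator (fun _ => w k) s)
          = (Set.Ioc (t (k - 1)) (t k)).indicator (fun s => omega β (x - s) * w k) := by
        funext s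
        by_cases hs : s ∈ Set.Ioc (t (k - 1)) (t k) <;> simp [hs]
      rw [e]
      have := (intervalIntegrable_omega hβ0 x 0 x).mul_const (w k)
      exact ⟨this.1.indicator measurableSet_Ioc, this.2.indicator measurableSet_Ioc⟩
  rw [avgIntegral, intervalIntegral.integral_congr hin, intervalIntegral.integral_finsetSum,
    Finset.mul_sum]
  · apply Finset.sum_congr rfl
    intro k hk
    rw [Finset.mem_Icc] at hk
    have := (ht.step_pos hk.1 (hk.2.trans hnN)).ne'
    rw [intervalIntegral.integral_mul_const, kernel]
    field_simp
  · intro k _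
    apply Continuous.intervalIntegrable
    simp_rw [integral_omega hβ0]
    exact (((continuous_rpow_sub_const hβ0 _).sub ((continuous_id.sub
      (continuous_id.min continuous_const)).rpow_const fun _ => Or.inr hβ0.le)).div_const
      _).mul_const _

/-- The sequence `vSeq` uses the doubled diagonal, so half of that term is taken back; this is the
source of the quadratic term in `discrete_gradient`. -/
theorem avgIntegral_eq_vSeq_sub (hβ0 : 0 < β) (ht : IsMesh N t) (ζ : ℕ → ℝ × ℝ → ℝ) (z : ℝ × ℝ)
    {n : ℕ} (hn : 1 ≤ n) (hnN : n ≤ N) :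
    avgIntegral β N t (fun k => ζ k z) n
      = vSeq β t ζ n z - 1 / 2 * modKernel β t n n * (step t n * ζ n z) := by
  obtain ⟨m, rfl⟩ : ∃ m, n = m + 1 := ⟨n - 1, by omega⟩
  rw [avgIntegral_eq hβ0 ht _ hn hnN, vSeq, Finset.sum_Icc_succ_top (by omega),
    Finset.sum_Icc_succ_top (by omega)]
  have : ∑ k ∈ Finset.Icc 1 m, kernel β t (m + 1) k * step t k * ζ k z
      = ∑ k ∈ Finset.Icc 1 m, modKernel β t (m + 1) k * step t k * ζ k z := by
    apply Finset.sum_congr rfl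
    intro k hk
    rw [Finset.mem_Icc] at hk
    rw [modKernel, if_neg (by omega)]
  rw [this, modKernel, if_pos rfl]
  ring

end AvgIntegral

/-! ### Integrating the discrete gradient identity over the cell. -/

section DissipationLaw

variable {L₁ L₂ : ℝ}

theorem integral_sum_mul_sq {μ : Measure (ℝ × ℝ)} (s : Finset ℕ) (c : ℕ → ℝ)
    (f : ℕ → ℝ × ℝ → ℝ) (hf : ∀ j ∈ s, MemLp (f j) 2 μ) :
    Integrable (fun z => ∑ j ∈ s, c j * f j z ^ 2) μ ∧
      ∫ z, ∑ j ∈ s, c j * f j z ^ 2 ∂μ = ∑ j ∈ s, c j * ∫ z, f j z ^ 2 ∂μ := by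
  have hi : ∀ j ∈ s, Integrable (fun z => c j * f j z ^ 2) μ := fun j hj =>
    (hf j hj).integrable_sq.const_mul _
  refine ⟨integrable_finsetSum s hi, ?_⟩
  rw [integral_finsetSum s hi]
  simp_rw [integral_const_mul]

/-- The increment of the variational energy, for a mesh on which the right-complementary kernels
do not vanish. -/
theorem varEnergy_sub (hL₁ : 0 < L₁) (hL₂ : 0 < L₂) {β ε : ℝ} (hβ0 : 0 < β) {N : ℕ} {t : ℕ → ℝ}
    (ht : IsMesh N t) {u g₁ g₂ ζ : ℕ → ℝ × ℝ → ℝ}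
    (hu : ∀ n, n ≤ N → HasPeriodicGradient L₁ L₂ (u n) (g₁ n) (g₂ n))
    (hCN : IsCNSolution L₁ L₂ ε β N t u ζ) {n : ℕ} (hn : n + 1 ≤ N)
    (hr : ∀ j, 1 ≤ j → j ≤ n + 1 → rcc (modKernel β t) (n + 1) j ≠ 0) :
    varEnergy L₁ L₂ ε β t u g₁ g₂ ζ (n + 1) - varEnergy L₁ L₂ ε β t u g₁ g₂ ζ n
      = -(1 / 2 * ∑ j ∈ Finset.Icc 1 n,
          (1 / rcc (modKernel β t) (n + 1) j - 1 / rcc (modKernel β t) (n + 1) (j + 1))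
            * normSq L₁ L₂ (fun z => ∑ k ∈ Finset.Icc 1 j, rcc (modKernel β t) (n + 1) k
                  * (vSeq β t ζ k z - vSeq β t ζ (k - 1) z))) := by
  have hne : ∀ i, 1 ≤ i → i ≤ N → modKernel β t i i ≠ 0 := fun i h1 h2 =>
    (modKernel_pos hβ0 ht i i h1 le_rfl h2).ne'
  obtain ⟨hpot, heq⟩ := hCN (n + 1) (by omega) hn
  rw [Nat.add_sub_cancel] at hpot heq
  have hE := hpot.integral_sub_mul hL₁ hL₂ (hu (n + 1) hn) (hu n (by omega))
  have hv : ∀ j, j ≤ N → MemLp (vSeq β t ζ j) 2 (cell L₁ L₂) := by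
    intro j hj
    unfold vSeq
    apply memLp_finsetSum
    intro l hl
    rw [Finset.mem_Icc] at hl
    exact (hCN l hl.1 (by omega)).1.1.const_mul _
  have hS : ∀ j, j ≤ N → MemLp (fun z => ∑ k ∈ Finset.Icc 1 j, rcc (modKernel β t) (n + 1) k
      * (vSeq β t ζ k z - vSeq β t ζ (k - 1) z)) 2 (cell L₁ L₂) := by
    intro j hj
    apply memLp_finsetSum
    intro l hl
    rw [Finset.mem_Icc] at hl
    exact ((hv l (by omega)).sub (hv (l - 1) (by omega))).const_mul _
  have hτ := (ht.step_pos (by omega : 1 ≤ n + 1) hn).ne'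
  have hpt : ∀ z, 2 * vSeq β t ζ (n + 1) z * (step t (n + 1) * ζ (n + 1) z)
      - modKernel β t (n + 1) (n + 1) * (step t (n + 1) * ζ (n + 1) z) ^ 2
      = ∑ j ∈ Finset.Icc 1 (n + 1), dcc (modKernel β t) (n + 1) j * vSeq β t ζ j z ^ 2
        - ∑ j ∈ Finset.Icc 1 n, dcc (modKernel β t) n j * vSeq β t ζ j z ^ 2
        + ∑ j ∈ Finset.Icc 1 n,
          (1 / rcc (modKernel β t) (n + 1) j - 1 / rcc (modKernel β t) (n + 1) (j + 1))
          * (∑ k ∈ Finset.Icc 1 j, rcc (modKernel β t) (n + 1) k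
            * (vSeq β t ζ k z - vSeq β t ζ (k - 1) z)) ^ 2 := fun z =>
    discrete_gradient hne (fun l => step t l * ζ l z) (fun j => vSeq β t ζ j z)
      (fun j => by simp only [vSeq, mul_assoc]) hn hr
  -- The scheme multiplied by `ζ` is minus one half of the left side of `hpt`.
  have hae : ∀ᵐ z ∂(cell L₁ L₂), (u (n + 1) z - u n z) * ζ (n + 1) z
      = -(1 / 2) * (2 * vSeq β t ζ (n + 1) z * (step t (n + 1) * ζ (n + 1) z)
      - modKernel β t (n + 1) (n + 1) * (step t (n + 1) * ζ (n + 1) z) ^ 2) := by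
    filter_upwards [heq] with z hz
    rw [avgIntegral_eq_vSeq_sub hβ0 ht ζ z (by omega) hn] at hz
    have : u (n + 1) z - u n z = -step t (n + 1) * (vSeq β t ζ (n + 1) z
        - 1 / 2 * modKernel β t (n + 1) (n + 1) * (step t (n + 1) * ζ (n + 1) z)) := by
      rw [add_eq_zero_iff_eq_neg, div_eq_iff hτ] at hz
      rw [hz]
      ring
    rw [this]
    ring
  obtain ⟨i1, e1⟩ := integral_sum_mul_sq (μ := cell L₁ L₂) (Finset.Icc 1 (n + 1))
    (dcc (modKernel β t) (n + 1)) (vSeq β t ζ)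
    (fun j hj => hv j (by rw [Finset.mem_Icc] at hj; omega))
  obtain ⟨i2, e2⟩ := integral_sum_mul_sq (μ := cell L₁ L₂) (Finset.Icc 1 n)
    (dcc (modKernel β t) n) (vSeq β t ζ)
    (fun j hj => hv j (by rw [Finset.mem_Icc] at hj; omega))
  obtain ⟨i3, e3⟩ := integral_sum_mul_sq (μ := cell L₁ L₂) (Finset.Icc 1 n)
    (fun j => 1 / rcc (modKernel β t) (n + 1) j - 1 / rcc (modKernel β t) (n + 1) (j + 1))
    (fun j z => ∑ k ∈ Finset.Icc 1 j, rcc (modKernel β t) (n + 1) k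
            * (vSeq β t ζ k z - vSeq β t ζ (k - 1) z))
    (fun j hj => hS j (by rw [Finset.mem_Icc] at hj; omega))
  rw [integral_congr_ae hae, integral_const_mul] at hE
  simp_rw [hpt] at hE
  have i12 : Integrable (fun z =>
      ∑ j ∈ Finset.Icc 1 (n + 1), dcc (modKernel β t) (n + 1) j * vSeq β t ζ j z ^ 2
        - ∑ j ∈ Finset.Icc 1 n, dcc (modKernel β t) n j * vSeq β t ζ j z ^ 2) (cell L₁ L₂) :=
    i1.sub i2
  rw [integral_add i12 i3, integral_sub i1 i2, e1, e2, e3] at hE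
  simp only [varEnergy, normSq]
  linarith

end DissipationLaw

end TFKG

theorem mainTheorem5 (β : ℝ) (hβ0 : 0 < β) (hβ1 : β < 1) (ε : ℝ) (hε : 0 < ε)
    (L₁ L₂ : ℝ) (hL₁ : 0 < L₁) (hL₂ : 0 < L₂)
    (N : ℕ) (t : ℕ → ℝ) (ht : TFKG.IsMesh N t) (hr : TFKG.StepRatioConstraint β N t)
    (u g₁ g₂ ζ : ℕ → ℝ × ℝ → ℝ)
    (hu : ∀ n, n ≤ N → TFKG.HasPeriodicGradient L₁ L₂ (u n) (g₁ n) (g₂ n))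
    (hCN : TFKG.IsCNSolution L₁ L₂ ε β N t u ζ) :
    ∀ n, 1 ≤ n → n ≤ N →
      -- the discrete energy dissipation law
      (TFKG.varEnergy L₁ L₂ ε β t u g₁ g₂ ζ n - TFKG.varEnergy L₁ L₂ ε β t u g₁ g₂ ζ (n - 1))
          / TFKG.step t n
        + 1 / (2 * TFKG.step t n) * ∑ j ∈ Finset.Icc 1 (n - 1),
          (1 / TFKG.rcc (TFKG.modKernel β t) n j - 1 / TFKG.rcc (TFKG.modKernel β t) n (j + 1))
            * TFKG.normSq L₁ L₂ (fun z => ∑ k ∈ Finset.Icc 1 j,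
                TFKG.rcc (TFKG.modKernel β t) n k
                  * (TFKG.vSeq β t ζ k z - TFKG.vSeq β t ζ (k - 1) z)) = 0
      -- the complementary kernels are positive and the dissipation coefficients nonnegative
      ∧ (∀ j, 1 ≤ j → j ≤ n →
          0 < TFKG.dcc (TFKG.modKernel β t) n j ∧ 0 < TFKG.rcc (TFKG.modKernel β t) n j)
      ∧ (∀ j, 1 ≤ j → j ≤ n - 1 →
          0 ≤ 1 / TFKG.rcc (TFKG.modKernel β t) n j
            - 1 / TFKG.rcc (TFKG.modKernel β t) n (j + 1))
      -- energy stability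
      ∧ TFKG.varEnergy L₁ L₂ ε β t u g₁ g₂ ζ n ≤ TFKG.varEnergy L₁ L₂ ε β t u g₁ g₂ ζ (n - 1) := by
  intro n hn hnN
  have hpos := TFKG.modKernel_pos hβ0 ht
  have hdoc := TFKG.doc_nonpos hpos (TFKG.modKernel_mul_le hβ0 hβ1 ht hr)
  have hd := fun j (h1 : 1 ≤ j) (h2 : j ≤ n) =>
    TFKG.dcc_pos hpos (TFKG.modKernel_lt_right hβ0 hβ1 ht) hdoc h1 h2 hnN
  have hrc := fun j (h1 : 1 ≤ j) (h2 : j ≤ n) =>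
    TFKG.rcc_pos hpos (TFKG.modKernel_lt_left hβ0 hβ1 ht) hdoc h1 h2 hnN
  have hcoef : ∀ j, 1 ≤ j → j ≤ n - 1 → 0 ≤ 1 / TFKG.rcc (TFKG.modKernel β t) n j
      - 1 / TFKG.rcc (TFKG.modKernel β t) n (j + 1) := by
    intro j h1 h2
    apply sub_nonneg.mpr
    apply one_div_le_one_div_of_le (hrc j h1 (by omega))
    -- The `rcc` increase with `j` because they differ by a nonpositive `doc`.
    rw [TFKG.rcc_eq_add (by omega : j ≤ n)]
    linarith [hdoc n j h1 (by omega) hnN]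
  have hτ := ht.step_pos hn hnN
  obtain ⟨m, rfl⟩ : ∃ m, n = m + 1 := ⟨n - 1, by omega⟩
  have key := TFKG.varEnergy_sub hL₁ hL₂ hβ0 ht hu hCN hnN (fun j h1 h2 => (hrc j h1 h2).ne')
  simp only [Nat.add_sub_cancel] at hcoef ⊢
  refine ⟨?_, fun j h1 h2 => ⟨hd j h1 h2, hrc j h1 h2⟩, hcoef, ?_⟩
  · rw [key]
    field_simp
    ring
  · rw [← sub_nonpos, key, neg_nonpos]
    refine mul_nonneg (by norm_num) (Finset.sum_nonneg fun j hj => ?_)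
    rw [Finset.mem_Icc] at hj
    exact mul_nonneg (hcoef j hj.1 hj.2) (integral_nonneg fun z => sq_nonneg _)
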